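/- **Setting.** Let $p,q\ge 0$ be integers. For $\theta=(\theta_1,\dots,\theta_{p+q},d)\in\mathbb R^{p+q+1}$ put $a_\theta(z)=1-\sum_{i=1}^p\theta_iz^i$ and $b_\theta(z)=1-\sum_{j=1}^q\theta_{p+j}z^j$, and let $\alpha_j(d)=\prod_{k=0}^{j-1}\frac{k-d}{k+1}$ be the coefficients of the binomial series $(1-z)^d=\sum_{j\ge0}\alpha_j(d)z^j$ (so $\alpha_j(d)=\Gamma(j-d)/\{\Gamma(j+1)\Gamma(-d)\}$ when $d\notin\{0,1,2,\dots\}$). Let $\delta>0$ and $[d_1,d_2]\subset\,]-1/2,1/2[$, and let $\Theta_\delta$ be the set of all $\theta$ with $d\in[d_1,d_2]$ such that all complex roots of $a_\theta$ and of $b_\theta$ have modulus at least $1+\delta$. Let $\theta_0=(a_1,\dots,a_p,b_1,\dots,b_q,d_0)\in\Theta_\delta$ with $d_1-d_0>-1/2$. **Model.** Let $X=(X_t)_{t\in\mathbb Z}$ be a real, centered, second order stationary process that satisfies, with $L$ the back-shift operator, $a=a_{\theta_0}$ and $b=b_{\theta_0}$, the FARIMA$(p,d_0,q)$ equation $$a(L)(1-L)^{d_0}X_t=b(L)\epsilon_t\quad\text{a.s.,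 for all }t\in\mathbb Z,$$ where $(1-L)^{d_0}X_t=\sum_{j\ge0}\alpha_j(d_0)X_{t-j}$ converges in $\mathbb L^2$. The real noise $(\epsilon_t)_{t\in\mathbb Z}$ is in $\mathbb L^2$. Assume: * **(A0)** $\mathbb E[\epsilon_t]=0$, $\mathrm{Var}(\epsilon_t)=\sigma_\epsilon^2$ with $\sigma_\epsilon^2>0$, and $\mathrm{Cov}(\epsilon_t,\epsilon_{t+h})=0$ for all $t\in\mathbb Z$ and $h\ne0$. * **(A1)** All complex roots of $a$ and $b$ have modulus greater than $1$, $a$ and $b$ have no common factor, and $a_p$ and $b_q$ are not both zero (with the convention $a_0=b_0=1$). * **(A2)** $(\epsilon_t)_{t\in\mathbb Z}$ is strictly stationary and ergodic. **Estimator.** For $\theta\in\Theta_\delta$ define, from $X_1,X_2,\dots$, the residuals $\tilde\epsilon_t(\theta)$ recursively for $t\ge1$ by $$\tilde\epsilon_t(\theta)=\sum_{j=0}^{t-1}\alpha_j(d)X_{t-j}-\sum_{i=1}^p\theta_i\sum_{j=0}^{t-i-1}\alpha_j(d)X_{t-i-j}+\sum_{j=1}^q\theta_{p+j}\,\tilde\epsilon_{t-j}(\theta),$$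 where $\tilde\epsilon_t(\theta)=0$ for $t\le0$ and empty sums are zero, and put $Q_n(\theta)=\frac1n\sum_{t=1}^n\tilde\epsilon_t^2(\theta)$. For $n\ge1$ let the random vector $\hat\theta_n$ be a least squares estimator, that is, almost surely $\hat\theta_n\in\Theta_\delta$ and $Q_n(\hat\theta_n)=\min_{\theta\in\Theta_\delta}Q_n(\theta)$. **Theorem (Consistency).** Under these assumptions, $\hat\theta_n\to\theta_0$ in probability as $n\to\infty$. -/

import Mathlib

open MeasureTheory ProbabilityTheory Filter Topology

namespace Farima

/-- Parameters `θ = (a₁, …, a_p, b₁, …, b_q, d)` with the Euclidean norm. -/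
abbrev Param (p q : ℕ) : Type := EuclideanSpace ℝ (Fin (p + q + 1))

variable {p q : ℕ}

/-- The autoregressive coefficients; `ar θ i` is the coefficient number `i + 1`. -/
def ar (θ : Param p q) (i : Fin p) : ℝ := θ (Fin.castAdd 1 (Fin.castAdd q i))

/-- The moving average coefficients; `ma θ j` is the coefficient number `j + 1`. -/
def ma (θ : Param p q) (j : Fin q) : ℝ := θ (Fin.castAdd 1 (Fin.natAdd p j))

/-- The memory parameter `d`. -/
def mem (θ : Param p q) : ℝ := θ (Fin.last (p + q))

/-- The polynomial `1 - ∑_{i=1}^m c_i z^i`. -/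
noncomputable def lagPoly {m : ℕ} (c : Fin m → ℝ) : Polynomial ℝ :=
  1 - ∑ i : Fin m, Polynomial.C (c i) * Polynomial.X ^ ((i : ℕ) + 1)

/-- The coefficients `α_j(d)` of the generalized binomial series
`(1 - z)^d = ∑_j α_j(d) z^j`, that is `α_j(d) = ∏_{k < j} (k - d) / (k + 1)`. Written as a product
so that `d = 0` (where `Γ(-d)` has a pole) needs no convention. -/
noncomputable def fracCoeff (d : ℝ) (j : ℕ) : ℝ :=
  ∏ k ∈ Finset.range j, ((k : ℝ) - d) / ((k : ℝ) + 1)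

/-- The Gamma function form of `α_j(d)`, wherever the formula makes sense. -/
theorem fracCoeff_eq_Gamma {d : ℝ} (hd : ∀ m : ℕ, d ≠ m) (j : ℕ) :
    fracCoeff d j =
      Real.Gamma ((j : ℝ) - d) / (Real.Gamma ((j : ℝ) + 1) * Real.Gamma (-d)) := by
  have h0 : Real.Gamma (-d) ≠ 0 := Real.Gamma_ne_zero fun m h => hd m (by linarith)
  induction j with
  | zero => simp [fracCoeff, Real.Gamma_one, h0]
  | succ j ih =>
    have h1 : (j : ℝ) - d ≠ 0 := fun h => hd j (by linarith)
    have h2 : (j : ℝ) + 1 ≠ 0 := by positivity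
    have h3 : Real.Gamma ((j : ℝ) + 1) ≠ 0 := (Real.Gamma_pos_of_pos (by positivity)).ne'
    have e1 : ((j + 1 : ℕ) : ℝ) - d = ((j : ℝ) - d) + 1 := by push_cast; ring
    have e2 : ((j + 1 : ℕ) : ℝ) = (j : ℝ) + 1 := by push_cast; ring
    rw [e1, e2, Real.Gamma_add_one h1, Real.Gamma_add_one h2]
    unfold fracCoeff at ih ⊢
    rw [Finset.prod_range_succ, ih]
    field_simp

/-- The truncated fractional difference `∑_{j=0}^{t-1} α_j(d) x_{t-j}` of a trajectory `x`;
it only involves `x_1, …, x_t`, and is zero for `t = 0`. -/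
noncomputable def truncDiff (d : ℝ) (x : ℤ → ℝ) (t : ℕ) : ℝ :=
  ∑ j ∈ Finset.range t, fracCoeff d j * x ((t : ℤ) - (j : ℤ))

/-- The residuals `ε̃_t(θ)` of a trajectory `x`, started at zero:
`ε̃_t(θ) = ∑_{j=0}^{t-1} α_j(d) x_{t-j} - ∑_{i=1}^p θ_i ∑_{j=0}^{t-i-1} α_j(d) x_{t-i-j}
  + ∑_{j=1}^q θ_{p+j} ε̃_{t-j}(θ)` for `t ≥ 1`. Terms with a time index `≤ 0` are zero; the
truncated subtraction of natural numbers sends those indices to `0`. -/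
noncomputable def lsResidual (θ : Param p q) (x : ℤ → ℝ) : ℕ → ℝ
  | 0 => 0
  | t + 1 =>
      truncDiff (mem θ) x (t + 1)
        - ∑ i : Fin p, ar θ i * truncDiff (mem θ) x (t + 1 - ((i : ℕ) + 1))
        + ∑ j : Fin q, ma θ j * lsResidual θ x (t + 1 - ((j : ℕ) + 1))
  termination_by t => t
  decreasing_by omega

/-- The least squares criterion `Q_n(θ) = (1/n) ∑_{t=1}^n ε̃_t(θ)²`. -/
noncomputable def lsCriterion (n : ℕ) (x : ℤ → ℝ) (θ : Param p q) : ℝ :=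
  (1 / (n : ℝ)) * ∑ t ∈ Finset.Icc 1 n, lsResidual θ x t ^ 2

/-- The parameter set `Θ_δ`: all complex roots of the two polynomials have modulus at least
`1 + δ`, and `d ∈ [d₁, d₂]`. -/
def paramSet (p q : ℕ) (δ d₁ d₂ : ℝ) : Set (Param p q) :=
  {θ | (∀ z : ℂ, Polynomial.aeval z (lagPoly (ar θ)) = 0 → 1 + δ ≤ ‖z‖) ∧
       (∀ z : ℂ, Polynomial.aeval z (lagPoly (ma θ)) = 0 → 1 + δ ≤ ‖z‖) ∧
       mem θ ∈ Set.Icc d₁ d₂}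

/-- The root conditions for a model of order `(p, q)`: the roots of `a` and `b` lie outside the
closed unit disk, `a` and `b` have no common factor, and the order is not overstated in both
polynomials at once (`a_p` and `b_q` are not both zero, with `a_0 = b_0 = 1`). -/
structure RootConditions (θ : Param p q) : Prop where
  ar_roots : ∀ z : ℂ, Polynomial.aeval z (lagPoly (ar θ)) = 0 → 1 < ‖z‖
  ma_roots : ∀ z : ℂ, Polynomial.aeval z (lagPoly (ma θ)) = 0 → 1 < ‖z‖
  coprime : IsCoprime (lagPoly (ar θ)) (lagPoly (ma θ))
  order : (lagPoly (ar θ)).natDegree = p ∨ (lagPoly (ma θ)).natDegree = q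

variable {Ω : Type*} [MeasurableSpace Ω]

/-- Centered second order stationary processes. -/
structure IsCenteredStationary (P : Measure Ω) (X : ℤ → Ω → ℝ) : Prop where
  memLp : ∀ t, MemLp (X t) 2 P
  mean : ∀ t, ∫ ω, X t ω ∂P = 0
  cov : ∀ s t h : ℤ, covariance (X s) (X (s + h)) P = covariance (X t) (X (t + h)) P

/-- Weak white noise with variance `v > 0`: square integrable, centered, uncorrelated. -/
structure IsWeakWhiteNoise (P : Measure Ω) (ε : ℤ → Ω → ℝ) (v : ℝ) : Prop where
  var_pos : 0 < v
  memLp : ∀ t, MemLp (ε t) 2 P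
  mean : ∀ t, ∫ ω, ε t ω ∂P = 0
  var : ∀ t, variance (ε t) P = v
  cov : ∀ t h : ℤ, h ≠ 0 → covariance (ε t) (ε (t + h)) P = 0

/-- Strict stationarity and ergodicity: the shift preserves the law of the whole process on
`ℝ^ℤ` and is ergodic for it. -/
def IsStationaryErgodic (P : Measure Ω) (ε : ℤ → Ω → ℝ) : Prop :=
  Ergodic (fun (x : ℤ → ℝ) (t : ℤ) => x (t + 1)) (P.map fun ω t => ε t ω)

/-- The equation `a(L) (1 - L)^d X_t = b(L) ε_t` for all `t`, almost surely; the series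
`U_t = (1 - L)^d X_t = ∑_{j ≥ 0} α_j(d) X_{t-j}` converges in `L²`. -/
def IsFarima (P : Measure Ω) (θ : Param p q) (X ε : ℤ → Ω → ℝ) : Prop :=
  ∃ U : ℤ → Ω → ℝ,
    (∀ t, MemLp (U t) 2 P) ∧
    (∀ t : ℤ, Tendsto
      (fun N : ℕ => eLpNorm (fun ω =>
        ∑ j ∈ Finset.range N, fracCoeff (mem θ) j * X (t - (j : ℤ)) ω - U t ω) 2 P)
      atTop (𝓝 0)) ∧
    ∀ t : ℤ, ∀ᵐ ω ∂P,
      U t ω - ∑ i : Fin p, ar θ i * U (t - (((i : ℕ) : ℤ) + 1)) ω =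
        ε t ω - ∑ j : Fin q, ma θ j * ε (t - (((j : ℕ) : ℤ) + 1)) ω

/-- A sequence `(θ̂_n)_{n ≥ 1}` of random variables that almost surely minimize `Q_n` over
`Θ`. -/
def IsLeastSquaresEstimator (P : Measure Ω) (X : ℤ → Ω → ℝ) (Θ : Set (Param p q))
    (θhat : ℕ → Ω → Param p q) : Prop :=
  ∀ n : ℕ, 1 ≤ n → AEMeasurable (θhat n) P ∧
    ∀ᵐ ω ∂P, θhat n ω ∈ Θ ∧
      ∀ θ ∈ Θ, lsCriterion n (fun t => X t ω) (θhat n ω) ≤ lsCriterion n (fun t => X t ω) θ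

end Farima

/-!
# Consistency of the least squares estimator of a FARIMA process

Started at zero, every filter acts on sequences indexed by `ℕ` as multiplication of formal power
series. Hence the residuals at `θ` are exactly the residuals at `θ₀` multiplied by the series
`g_θ = a_θ b_{θ₀} / (b_θ a_{θ₀}) (1 - z)^{d - d₀}` (`residualSeries_eq_transfer_mul`), and the process
`X` enters only through the residuals `e_t` at `θ₀`. These satisfy `e_t - ε_t → 0` in `L²`
(`tendsto_lpNorm_deviation`): stationarity makes the remainders of `(1 - L)^{d₀} X_t` independent of
`t` in norm, and `1 / b_{θ₀}` is absolutely summable. By the mean ergodic theorem the sample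
covariances of `e` at all lags then converge in mean to those of a white noise of variance `v`
(`tendsto_integral_lagCov`), so every sequence of sample sizes has a subsequence along which they
converge almost surely. What remains is a deterministic statement about one trajectory
(`tendsto_of_lagCov_tendsto`).

There, `Q_n(θ₀) → v` is an upper bound for the minimum. For the lower bound, `g_θ` itself may fail to
be summable, because `d - d₀` may be negative. The filter `h_s = (1 + s)/2 · (1 - z)/(1 - s z)` is a
contraction on truncated sequences (`sum_sq_notch_mul_le`), so `Q_n(θ)` is at least the energy of
`h_s g_θ e`. Since `d - d₀ > -1/2`, the coefficients of `h_s g_θ` are dominated by a summable sequence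
uniformly in `θ` (`exists_majorant`), and dominated convergence turns this energy into
`v ∑_j [z^j](h_s g_θ)²`. For a limit point `θ'` of the minimizers this gives
`∑_j [z^j](h_s g_{θ'})² ≤ 1`; letting `s → 1` gives `∑_j [z^j](g_{θ'})² ≤ 1`, and as the constant
coefficient of `g_{θ'}` is `1`, all the others vanish. So `g_{θ'} = 1`, which forces `θ' = θ₀`
(`eq_of_transfer_eq_one`): a power `(1 - z)^s` with `|s| < 1` is rational only for `s = 0`, and
the coprimality and order conditions then identify the two polynomials.
-/

namespace Farima
open PowerSeries

/-! ### The binomial series as a formal power series -/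

/-- The formal power series `(1 - z)^d = ∑_j α_j(d) z^j`. -/
noncomputable def fracSeries (d : ℝ) : ℝ⟦X⟧ := PowerSeries.mk (fracCoeff d)

theorem fracCoeff_zero (d : ℝ) : fracCoeff d 0 = 1 := by simp [fracCoeff]

theorem fracCoeff_succ (d : ℝ) (j : ℕ) :
    ((j : ℝ) + 1) * fracCoeff d (j + 1) = ((j : ℝ) - d) * fracCoeff d j := by
  have : ((j : ℝ) + 1) ≠ 0 := by positivity
  rw [fracCoeff, Finset.prod_range_succ, ← fracCoeff]
  field_simp

/-- The differential equation `(1 - z) F' = -d F` in coefficient form. Together with the constant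
coefficient it determines the series. -/
theorem eq_fracSeries_of_deriv {d : ℝ} {F : ℝ⟦X⟧} (h0 : coeff 0 F = 1)
    (h : (1 - X) * derivative ℝ F = -(C d * F)) : F = fracSeries d := by
  have key : ∀ n : ℕ, ((n : ℝ) + 1) * coeff (n + 1) F = ((n : ℝ) - d) * coeff n F := by
    intro n
    have hn := congrArg (coeff n) h
    rw [sub_mul, one_mul, map_sub, map_neg, coeff_C_mul, coeff_derivative] at hn
    cases n with
    | zero => simp at hn ⊢; linarith
    | succ n =>
      rw [coeff_succ_X_mul, coeff_derivative] at hn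
      push_cast at hn ⊢
      linarith
  ext n
  rw [fracSeries, coeff_mk]
  induction n with
  | zero => rw [h0, fracCoeff_zero]
  | succ n ih =>
    have h1 := key n
    rw [ih, ← fracCoeff_succ] at h1
    exact mul_left_cancel₀ (by positivity) h1

theorem fracSeries_deriv (d : ℝ) :
    (1 - X) * derivative ℝ (fracSeries d) = -(C d * fracSeries d) := by
  ext n
  rw [sub_mul, one_mul, map_sub, map_neg, coeff_C_mul, coeff_derivative]
  cases n with
  | zero =>
    have := fracCoeff_succ d 0
    simp [fracSeries] at this ⊢; linarith
  | succ n =>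
    have h1 := fracCoeff_succ d n
    have h2 := fracCoeff_succ d (n + 1)
    rw [coeff_succ_X_mul, coeff_derivative]
    simp only [fracSeries, coeff_mk]
    push_cast at h1 h2 ⊢
    linarith

theorem coeff_zero_fracSeries (d : ℝ) : coeff 0 (fracSeries d) = 1 := by
  simp [fracSeries, fracCoeff_zero]

theorem constantCoeff_fracSeries (d : ℝ) : constantCoeff (fracSeries d) = 1 := by
  rw [← coeff_zero_eq_constantCoeff_apply, coeff_zero_fracSeries]

/-- `(1 - z)^d (1 - z)^e = (1 - z)^{d + e}`. -/
theorem fracSeries_mul (d e : ℝ) : fracSeries d * fracSeries e = fracSeries (d + e) := by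
  apply eq_fracSeries_of_deriv
  · simp [constantCoeff_fracSeries]
  · rw [Derivation.leibniz, smul_eq_mul, smul_eq_mul, map_add]
    linear_combination fracSeries d * fracSeries_deriv e + fracSeries e * fracSeries_deriv d

theorem fracSeries_zero : fracSeries 0 = 1 :=
  (eq_fracSeries_of_deriv (by simp) (by simp)).symm

theorem fracSeries_one : fracSeries 1 = 1 - X := by
  refine (eq_fracSeries_of_deriv (by simp) ?_).symm
  simp [derivative_X]

/-- The partial sums of `∑_j α_j(d)` are the coefficients of `(1 - z)^{d - 1}`. -/
theorem sum_fracCoeff (d : ℝ) (n : ℕ) :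
    ∑ j ∈ Finset.range (n + 1), fracCoeff d j = fracCoeff (d - 1) n := by
  have h : fracSeries d = (1 - X) * fracSeries (d - 1) := by
    rw [← fracSeries_one, fracSeries_mul]; ring_nf
  have hc : ∀ m : ℕ, fracCoeff d (m + 1) = fracCoeff (d - 1) (m + 1) - fracCoeff (d - 1) m := by
    intro m
    have := congrArg (coeff (m + 1)) h
    rw [sub_mul, one_mul, map_sub, coeff_succ_X_mul] at this
    simpa [fracSeries] using this
  induction n with
  | zero => simp [fracCoeff_zero]
  | succ n ih => rw [Finset.sum_range_succ, ih, hc]; ring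

theorem fracCoeff_neg_half_nonneg (n : ℕ) : 0 ≤ fracCoeff (-(1 / 2)) n :=
  Finset.prod_nonneg fun k _ => by
    have : (0 : ℝ) ≤ k := by positivity
    apply div_nonneg <;> linarith

theorem fracCoeff_half_succ_nonpos (n : ℕ) : fracCoeff (1 / 2) (n + 1) ≤ 0 := by
  rw [fracCoeff, Finset.prod_range_succ']
  refine mul_nonpos_of_nonneg_of_nonpos (Finset.prod_nonneg fun k _ => ?_) (by norm_num)
  have : (0 : ℝ) ≤ k := by positivity
  push_cast
  apply div_nonneg <;> linarith

/-- The series `∑_j |α_j(1/2)|` converges: all its terms but the first have the same sign, and the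
partial sums of `α_j(1/2)` are nonnegative. -/
theorem summable_abs_fracCoeff_half : Summable fun j => |fracCoeff (1 / 2) j| := by
  refine (summable_nat_add_iff 1).1 (summable_of_sum_range_le (c := 1) (fun _ => abs_nonneg _) ?_)
  intro n
  have h1 := sum_fracCoeff (1 / 2) n
  rw [Finset.sum_range_succ', fracCoeff_zero] at h1
  have h2 := fracCoeff_neg_half_nonneg n
  rw [show (1 / 2 : ℝ) - 1 = -(1 / 2) by norm_num] at h1
  rw [Finset.sum_congr rfl fun j _ => abs_of_nonpos (fracCoeff_half_succ_nonpos j),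
    Finset.sum_neg_distrib]
  linarith

/-- For `d ∈ [1/2, 2]` the coefficients are dominated by those of exponent `1/2`. The ratio of two
consecutive terms compares from index `2` on; the factor `8` covers the first ones. -/
theorem abs_fracCoeff_le {d : ℝ} (h1 : 1 / 2 ≤ d) (h2 : d ≤ 2) (j : ℕ) :
    |fracCoeff d j| ≤ 8 * |fracCoeff (1 / 2) j| := by
  rcases j with _ | _ | j
  · simp [fracCoeff]
  · simp [fracCoeff]; rw [abs_of_nonneg (by linarith)]; norm_num; linarith
  · induction j with
    | zero =>
      simp only [fracCoeff, Finset.prod_range_succ, Finset.prod_range_zero, abs_mul, abs_div]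
      norm_num
      have ha : |d| ≤ 2 := by rw [abs_of_nonneg] <;> linarith
      have hb : |1 - d| ≤ 1 := by rw [abs_le]; constructor <;> linarith
      nlinarith [abs_nonneg d, abs_nonneg (1 - d)]
    | succ j ih =>
      have e : ∀ x : ℝ, fracCoeff x (j + 2 + 1) =
          fracCoeff x (j + 2) * ((((j + 2 : ℕ) : ℝ) - x) / (((j + 2 : ℕ) : ℝ) + 1)) := by
        intro x; rw [fracCoeff, Finset.prod_range_succ, ← fracCoeff]
      rw [show j + 1 + 1 + 1 = j + 2 + 1 by ring, e d, e (1 / 2), abs_mul, abs_mul, ← mul_assoc]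
      have hj : (0 : ℝ) ≤ j := by positivity
      refine mul_le_mul ih ?_ (abs_nonneg _) (by positivity)
      rw [abs_div, abs_div]
      refine div_le_div_of_nonneg_right ?_ (abs_nonneg _)
      push_cast
      rw [abs_of_nonneg (by linarith), abs_of_nonneg (by linarith)]
      linarith

/-! ### Majorants and absolutely summable power series -/

/-- `Majorized f M`: the coefficients of `f` are bounded in norm by those of the real series `M`. -/
def Majorized {𝕜 : Type*} [NormedField 𝕜] (f : 𝕜⟦X⟧) (M : ℝ⟦X⟧) : Prop :=
  ∀ n, ‖coeff n f‖ ≤ coeff n M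

/-- A power series whose coefficients are absolutely summable. -/
def AbsSummable (f : ℝ⟦X⟧) : Prop := Summable fun n => ‖coeff n f‖

section Majorant
variable {𝕜 : Type*} [NormedField 𝕜]

theorem Majorized.coeff_nonneg {f : 𝕜⟦X⟧} {M : ℝ⟦X⟧} (h : Majorized f M) (n : ℕ) :
    0 ≤ coeff n M := (norm_nonneg _).trans (h n)

theorem Majorized.mul {f g : 𝕜⟦X⟧} {M N : ℝ⟦X⟧} (hf : Majorized f M) (hg : Majorized g N) :
    Majorized (f * g) (M * N) := by
  intro n
  rw [coeff_mul, coeff_mul]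
  refine (norm_sum_le _ _).trans (Finset.sum_le_sum fun x _ => ?_)
  rw [norm_mul]
  exact mul_le_mul (hf _) (hg _) (norm_nonneg _) (hf.coeff_nonneg _)

theorem majorized_one : Majorized (1 : 𝕜⟦X⟧) 1 := by
  intro n
  rw [coeff_one, coeff_one]
  split_ifs <;> simp

theorem Majorized.pow {f : 𝕜⟦X⟧} {M : ℝ⟦X⟧} (hf : Majorized f M) (n : ℕ) :
    Majorized (f ^ n) (M ^ n) := by
  induction n with
  | zero => simpa using majorized_one
  | succ n ih => rw [pow_succ, pow_succ]; exact ih.mul hf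

theorem AbsSummable.mul {f g : ℝ⟦X⟧} (hf : AbsSummable f) (hg : AbsSummable g) :
    AbsSummable (f * g) := by
  have := summable_norm_sum_mul_antidiagonal_of_summable_norm hf hg
  simpa only [AbsSummable, coeff_mul] using this

theorem absSummable_one : AbsSummable 1 := by
  refine summable_of_ne_finset_zero (s := {0}) fun n hn => ?_
  rw [coeff_one, if_neg (by simpa using hn), norm_zero]

theorem AbsSummable.pow {f : ℝ⟦X⟧} (hf : AbsSummable f) (n : ℕ) : AbsSummable (f ^ n) := by
  induction n with
  | zero => simpa using absSummable_one
  | succ n ih => rw [pow_succ]; exact ih.mul hf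

theorem AbsSummable.of_majorized {f M : ℝ⟦X⟧} (hM : AbsSummable M) (h : Majorized f M) :
    AbsSummable f :=
  Summable.of_nonneg_of_le (fun _ => norm_nonneg _) (fun n => (h n).trans (le_abs_self _)) hM

/-- The geometric series `∑_n w^n z^n = (1 - w z)⁻¹`. -/
def geomSeries (w : 𝕜) : 𝕜⟦X⟧ := PowerSeries.mk fun n => w ^ n

theorem one_sub_mul_geomSeries (w : 𝕜) : (1 - C w * X) * geomSeries w = 1 := by
  ext n
  rw [sub_mul, one_mul, map_sub, mul_assoc, coeff_C_mul, coeff_one]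
  cases n with
  | zero => simp [geomSeries]
  | succ n => rw [coeff_succ_X_mul]; simp [geomSeries, pow_succ']

theorem majorized_geomSeries {w : 𝕜} {r : ℝ} (h : ‖w‖ ≤ r) :
    Majorized (geomSeries w) (geomSeries r) := by
  intro n
  simp only [geomSeries, coeff_mk, norm_pow]
  exact pow_le_pow_left₀ (norm_nonneg _) h n

theorem majorized_one_sub {w : 𝕜} {r : ℝ} (h : ‖w‖ ≤ r) :
    Majorized (1 - C w * X) (geomSeries r) := by
  have hr : 0 ≤ r := (norm_nonneg _).trans h
  intro n
  rcases n with _ | _ | n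
  · simp [geomSeries]
  · simp [geomSeries, coeff_one, h]
  · simp only [map_sub, coeff_C_mul, coeff_X, coeff_one, geomSeries, coeff_mk]
    simp; positivity

theorem majorized_one_geomSeries {r : ℝ} (h : 0 ≤ r) :
    Majorized (1 : 𝕜⟦X⟧) (geomSeries r) := by
  simpa using majorized_one_sub (w := (0 : 𝕜)) (by simpa using h)

theorem Majorized.mono_pow {f : 𝕜⟦X⟧} {r : ℝ} (hr : 0 ≤ r) {m n : ℕ} (hmn : m ≤ n)
    (hf : Majorized f (geomSeries r ^ m)) : Majorized f (geomSeries r ^ n) := by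
  have h := hf.mul ((majorized_one_geomSeries (𝕜 := 𝕜) hr).pow (n - m))
  rwa [one_pow, mul_one, ← pow_add, Nat.add_sub_cancel' hmn] at h

theorem absSummable_geomSeries {r : ℝ} (h0 : 0 ≤ r) (h1 : r < 1) : AbsSummable (geomSeries r) := by
  simpa [AbsSummable, geomSeries, abs_of_nonneg h0] using summable_geometric_of_lt_one h0 h1

theorem majorized_prod_one_sub {r : ℝ} (s : Multiset 𝕜) (h : ∀ w ∈ s, ‖w‖ ≤ r) :
    Majorized (s.map fun w => 1 - C w * X).prod (geomSeries r ^ s.card) := by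
  induction s using Multiset.induction_on with
  | empty => simpa using majorized_one
  | cons a s ih =>
    rw [Multiset.map_cons, Multiset.prod_cons, Multiset.card_cons, pow_succ']
    exact (majorized_one_sub (h a (by simp))).mul (ih fun w hw => h w (by simp [hw]))

theorem exists_inverse_prod_one_sub {r : ℝ} (s : Multiset 𝕜) (h : ∀ w ∈ s, ‖w‖ ≤ r) :
    ∃ g : 𝕜⟦X⟧, (s.map fun w => 1 - C w * X).prod * g = 1 ∧
      Majorized g (geomSeries r ^ s.card) := by
  induction s using Multiset.induction_on with
  | empty => exact ⟨1, by simp, by simpa using majorized_one⟩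
  | cons a s ih =>
    obtain ⟨g, h1, h2⟩ := ih fun w hw => h w (by simp [hw])
    refine ⟨geomSeries a * g, ?_, ?_⟩
    · rw [Multiset.map_cons, Multiset.prod_cons]
      linear_combination (s.map fun w => 1 - C w * X).prod * g * one_sub_mul_geomSeries a + h1
    · rw [Multiset.card_cons, pow_succ']
      exact (majorized_geomSeries (h a (by simp))).mul h2

end Majorant

/-! ### Lag polynomials without roots in a disk -/

theorem coeff_zero_lagPoly {m : ℕ} (c : Fin m → ℝ) : (lagPoly c).coeff 0 = 1 := by
  simp [lagPoly]

theorem coeff_succ_lagPoly {m : ℕ} (c : Fin m → ℝ) (i : Fin m) :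
    (lagPoly c).coeff ((i : ℕ) + 1) = -c i := by
  simp only [lagPoly, Polynomial.coeff_sub, Polynomial.coeff_one, Polynomial.finsetSum_coeff,
    Polynomial.coeff_C_mul, Polynomial.coeff_X_pow]
  rw [Finset.sum_eq_single i]
  · simp
  · intro b _ hb
    rw [if_neg, mul_zero]
    intro h; apply hb; ext; omega
  · simp

theorem natDegree_lagPoly_le {m : ℕ} (c : Fin m → ℝ) : (lagPoly c).natDegree ≤ m := by
  refine (Polynomial.natDegree_sub_le _ _).trans (max_le (by simp) ?_)
  refine Polynomial.natDegree_sum_le_of_forall_le _ _ fun i _ => ?_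
  exact (Polynomial.natDegree_C_mul_X_pow_le _ _).trans i.2

theorem constantCoeff_lagPoly {m : ℕ} (c : Fin m → ℝ) :
    constantCoeff (lagPoly c : ℝ⟦X⟧) = 1 := by
  rw [← coeff_zero_eq_constantCoeff_apply, Polynomial.coeff_coe, coeff_zero_lagPoly]

/-- A complex polynomial with constant coefficient `1` and no root in the disk of radius `R` is a
product of factors `1 - w z` with `‖w‖ ≤ R⁻¹`. -/
theorem exists_factorization {P : Polynomial ℂ} {R : ℝ} (hR : 0 < R) (h0 : P.coeff 0 = 1)
    (hroot : ∀ z : ℂ, P.IsRoot z → R ≤ ‖z‖) :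
    ∃ s : Multiset ℂ, s.card ≤ P.natDegree ∧ (∀ w ∈ s, ‖w‖ ≤ R⁻¹) ∧
      (P : ℂ⟦X⟧) = (s.map fun w => 1 - C w * X).prod := by
  have hP : P ≠ 0 := by rintro rfl; simp at h0
  have hz : ∀ z ∈ P.roots, R ≤ ‖z‖ := fun z hz => hroot z (Polynomial.isRoot_of_mem_roots hz)
  have key : ∀ t : Multiset ℂ, (∀ z ∈ t, R ≤ ‖z‖) → ∃ k : ℂ,
      ((t.map fun z => Polynomial.X - Polynomial.C z).prod : Polynomial ℂ) =
        Polynomial.C k *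
          ((t.map fun z => z⁻¹).map fun w => 1 - Polynomial.C w * Polynomial.X).prod := by
    intro t
    induction t using Multiset.induction_on with
    | empty => exact fun _ => ⟨1, by simp⟩
    | cons a t ih =>
      intro h
      obtain ⟨k, hk⟩ := ih fun z hz => h z (by simp [hz])
      have ha : a ≠ 0 := by
        rintro rfl; have := h 0 (by simp); rw [norm_zero] at this; linarith
      refine ⟨-a * k, ?_⟩
      simp only [Multiset.map_cons, Multiset.prod_cons]
      rw [hk]
      have e : (Polynomial.X - Polynomial.C a : Polynomial ℂ) =
          Polynomial.C (-a) * (1 - Polynomial.C a⁻¹ * Polynomial.X) := by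
        rw [mul_sub, ← mul_assoc, ← Polynomial.C_mul, neg_mul, mul_inv_cancel₀ ha]
        simp; ring
      rw [e, Polynomial.C_mul]
      ring
  obtain ⟨k, hk⟩ := key P.roots hz
  have hsplit := (IsAlgClosed.splits P).eq_prod_roots
  rw [hk, ← mul_assoc, ← Polynomial.C_mul] at hsplit
  have hc : P.leadingCoeff * k = 1 := by
    have := congrArg (Polynomial.eval 0) hsplit
    rw [← Polynomial.coeff_zero_eq_eval_zero, h0, Polynomial.eval_mul, Polynomial.eval_C,
      Polynomial.eval_multiset_prod, Multiset.map_map] at this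
    simpa using this.symm
  rw [hc, Polynomial.C_1, one_mul] at hsplit
  refine ⟨P.roots.map fun z => z⁻¹, ?_, ?_, ?_⟩
  · rw [Multiset.card_map]; exact Polynomial.card_roots' P
  · intro w hw
    obtain ⟨z, hz', rfl⟩ := Multiset.mem_map.1 hw
    rw [norm_inv]
    exact inv_anti₀ hR (hz z hz')
  · have := congrArg (Polynomial.coeToPowerSeries.ringHom (R := ℂ)) hsplit
    rw [map_multiset_prod, Multiset.map_map] at this
    simpa [Function.comp_def] using this

section Lag
variable {m : ℕ} {c : Fin m → ℝ} {δ : ℝ}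

theorem exists_factorization_lagPoly (hδ : 0 < δ)
    (h : ∀ z : ℂ, Polynomial.aeval z (lagPoly c) = 0 → 1 + δ ≤ ‖z‖) :
    ∃ s : Multiset ℂ, s.card ≤ m ∧ (∀ w ∈ s, ‖w‖ ≤ (1 + δ)⁻¹) ∧
      PowerSeries.map Complex.ofRealHom (lagPoly c : ℝ⟦X⟧) =
        (s.map fun w => 1 - C w * X).prod := by
  obtain ⟨s, h1, h2, h3⟩ := exists_factorization (P := (lagPoly c).map (algebraMap ℝ ℂ))
    (R := 1 + δ) (by linarith) (by simp [coeff_zero_lagPoly]) (fun z hz => h z (by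
      rwa [Polynomial.IsRoot.def, Polynomial.eval_map_algebraMap] at hz))
  refine ⟨s, h1.trans (Polynomial.natDegree_map_le.trans (natDegree_lagPoly_le c)), h2, ?_⟩
  rw [← h3]
  ext n
  simp

theorem inv_one_add_nonneg (hδ : 0 < δ) : 0 ≤ (1 + δ)⁻¹ := by positivity

theorem majorized_lagPoly (hδ : 0 < δ)
    (h : ∀ z : ℂ, Polynomial.aeval z (lagPoly c) = 0 → 1 + δ ≤ ‖z‖) :
    Majorized (lagPoly c : ℝ⟦X⟧) (geomSeries (1 + δ)⁻¹ ^ m) := by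
  obtain ⟨s, h1, h2, h3⟩ := exists_factorization_lagPoly hδ h
  have := (majorized_prod_one_sub s h2).mono_pow (inv_one_add_nonneg hδ) h1
  rw [← h3] at this
  intro n
  have hn := this n
  rwa [coeff_map, Complex.ofRealHom_eq_coe, Complex.norm_real] at hn

theorem majorized_lagPoly_inv (hδ : 0 < δ)
    (h : ∀ z : ℂ, Polynomial.aeval z (lagPoly c) = 0 → 1 + δ ≤ ‖z‖) :
    Majorized (lagPoly c : ℝ⟦X⟧)⁻¹ (geomSeries (1 + δ)⁻¹ ^ m) := by
  obtain ⟨s, h1, h2, h3⟩ := exists_factorization_lagPoly hδ h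
  obtain ⟨g, hg, hg'⟩ := exists_inverse_prod_one_sub s h2
  have hg'' := hg'.mono_pow (inv_one_add_nonneg hδ) h1
  have hinv : PowerSeries.map Complex.ofRealHom (lagPoly c : ℝ⟦X⟧) *
      PowerSeries.map Complex.ofRealHom (lagPoly c : ℝ⟦X⟧)⁻¹ = 1 := by
    rw [← map_mul, PowerSeries.mul_inv_cancel _
      (by rw [constantCoeff_lagPoly]; exact one_ne_zero), map_one]
  have : PowerSeries.map Complex.ofRealHom (lagPoly c : ℝ⟦X⟧)⁻¹ = g := by
    rw [h3] at hinv
    linear_combination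
      (-PowerSeries.map Complex.ofRealHom (lagPoly c : ℝ⟦X⟧)⁻¹) * hg + g * hinv
  rw [← this] at hg''
  intro n
  have hn := hg'' n
  rwa [coeff_map, Complex.ofRealHom_eq_coe, Complex.norm_real] at hn

theorem absSummable_geomSeries_pow (hδ : 0 < δ) (k : ℕ) :
    AbsSummable (geomSeries (1 + δ)⁻¹ ^ k) :=
  (absSummable_geomSeries (inv_one_add_nonneg hδ) (inv_lt_one_of_one_lt₀ (by linarith))).pow k

end Lag

/-! ### The residuals as a filter of the residuals at the true parameter -/

variable {p q : ℕ}

/-- The generating series `∑_{t ≥ 1} x_t z^t` of the observed part of a trajectory. -/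
noncomputable def pathSeries (x : ℤ → ℝ) : ℝ⟦X⟧ :=
  PowerSeries.mk fun t => if t = 0 then 0 else x t

/-- The generating series of the residuals `ε̃_t(θ)`, `t ≥ 1`. -/
noncomputable def residualSeries (θ : Param p q) (x : ℤ → ℝ) : ℝ⟦X⟧ :=
  PowerSeries.mk (lsResidual θ x)

/-- The rational filter `(a_θ / b_θ) / (a_{θ₀} / b_{θ₀})`. -/
noncomputable def rationalPart (θ₀ θ : Param p q) : ℝ⟦X⟧ :=
  ((lagPoly (ar θ) : ℝ⟦X⟧) * (lagPoly (ma θ) : ℝ⟦X⟧)⁻¹) *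
    ((lagPoly (ma θ₀) : ℝ⟦X⟧) * (lagPoly (ar θ₀) : ℝ⟦X⟧)⁻¹)

/-- The filter `a_θ b_{θ₀} / (b_θ a_{θ₀}) (1 - z)^{d - d₀}`, which carries the residuals at `θ₀` to
the residuals at `θ`. -/
noncomputable def transfer (θ₀ θ : Param p q) : ℝ⟦X⟧ :=
  rationalPart θ₀ θ * fracSeries (mem θ - mem θ₀)

theorem truncDiff_eq_coeff (d : ℝ) (x : ℤ → ℝ) (t : ℕ) :
    truncDiff d x t = coeff t (fracSeries d * pathSeries x) := by
  rw [coeff_mul, Finset.Nat.sum_antidiagonal_eq_sum_range_succ_mk, Finset.sum_range_succ]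
  simp only [fracSeries, pathSeries, coeff_mk, Nat.sub_self, if_true, mul_zero, add_zero]
  refine Finset.sum_congr rfl fun j hj => ?_
  have := Finset.mem_range.1 hj
  rw [if_neg (by omega), Nat.cast_sub this.le]

/-- Multiplication by a lag polynomial, for series without constant coefficient: the truncated
subtraction then reads off a zero wherever the lagged index is not positive. -/
theorem coeff_lagPoly_mul {m : ℕ} (c : Fin m → ℝ) {S : ℝ⟦X⟧} (hS : coeff 0 S = 0) (t : ℕ) :
    coeff t ((lagPoly c : ℝ⟦X⟧) * S) =
      coeff t S - ∑ i : Fin m, c i * coeff (t - ((i : ℕ) + 1)) S := by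
  have h : (lagPoly c : ℝ⟦X⟧) = 1 - ∑ i : Fin m, C (c i) * X ^ ((i : ℕ) + 1) := by
    have := map_sum (Polynomial.coeToPowerSeries.ringHom (R := ℝ))
      (fun i : Fin m => Polynomial.C (c i) * Polynomial.X ^ ((i : ℕ) + 1)) Finset.univ
    simp only [Polynomial.coeToPowerSeries.ringHom_apply] at this
    rw [lagPoly, Polynomial.coe_sub, this]
    simp
  rw [h, sub_mul, one_mul, map_sub, Finset.sum_mul, map_sum]
  congr 1
  refine Finset.sum_congr rfl fun i _ => ?_
  rw [mul_assoc, coeff_C_mul, coeff_X_pow_mul']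
  split_ifs with hi
  · rfl
  · rw [Nat.sub_eq_zero_of_le (by omega), hS]

theorem coeff_zero_residualSeries (θ : Param p q) (x : ℤ → ℝ) :
    coeff 0 (residualSeries θ x) = 0 := by
  rw [residualSeries, coeff_mk, lsResidual]

/-- The recursion of the residuals: `b_θ ε̃(θ) = a_θ (1 - z)^d x`. -/
theorem ma_mul_residualSeries (θ : Param p q) (x : ℤ → ℝ) :
    (lagPoly (ma θ) : ℝ⟦X⟧) * residualSeries θ x =
      (lagPoly (ar θ) : ℝ⟦X⟧) * (fracSeries (mem θ) * pathSeries x) := by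
  have h0 : coeff 0 (fracSeries (mem θ) * pathSeries x) = 0 := by
    rw [← truncDiff_eq_coeff]; simp [truncDiff]
  ext t
  rw [coeff_lagPoly_mul _ (coeff_zero_residualSeries θ x), coeff_lagPoly_mul _ h0]
  simp only [← truncDiff_eq_coeff, residualSeries, coeff_mk]
  cases t with
  | zero => simp [lsResidual, truncDiff]
  | succ t => rw [lsResidual]; ring

theorem lagPoly_mul_inv {m : ℕ} (c : Fin m → ℝ) :
    (lagPoly c : ℝ⟦X⟧) * (lagPoly c : ℝ⟦X⟧)⁻¹ = 1 :=
  PowerSeries.mul_inv_cancel _ (by rw [constantCoeff_lagPoly]; exact one_ne_zero)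

/-- The residuals at `θ` are exactly a causal filter of the residuals at `θ₀`, truncation at time
zero included, because causal convolutions of sequences on `ℕ` commute. -/
theorem residualSeries_eq_transfer_mul (θ₀ θ : Param p q) (x : ℤ → ℝ) :
    residualSeries θ x = transfer θ₀ θ * residualSeries θ₀ x := by
  have h := ma_mul_residualSeries θ x
  have h₀ := ma_mul_residualSeries θ₀ x
  have hb := lagPoly_mul_inv (ma θ)
  have ha₀ := lagPoly_mul_inv (ar θ₀)
  have hd : fracSeries (mem θ - mem θ₀) * fracSeries (mem θ₀) = fracSeries (mem θ) := by
    rw [fracSeries_mul]; ring_nf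
  rw [transfer, rationalPart]
  set A := (lagPoly (ar θ) : ℝ⟦X⟧)
  set B := (lagPoly (ma θ) : ℝ⟦X⟧)
  set A₀ := (lagPoly (ar θ₀) : ℝ⟦X⟧)
  set B₀ := (lagPoly (ma θ₀) : ℝ⟦X⟧)
  set S := residualSeries θ x
  set S₀ := residualSeries θ₀ x
  set Y := pathSeries x
  set F := fracSeries (mem θ - mem θ₀)
  calc S = B * B⁻¹ * S := by rw [hb, one_mul]
    _ = B⁻¹ * (B * S) := by ring
    _ = A * B⁻¹ * (F * fracSeries (mem θ₀)) * Y := by rw [h, hd]; ring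
    _ = A * B⁻¹ * F * (A₀ * A₀⁻¹) * (fracSeries (mem θ₀) * Y) := by rw [ha₀]; ring
    _ = A * B⁻¹ * F * A₀⁻¹ * (A₀ * (fracSeries (mem θ₀) * Y)) := by ring
    _ = A * B⁻¹ * F * A₀⁻¹ * (B₀ * S₀) := by rw [h₀]
    _ = A * B⁻¹ * (B₀ * A₀⁻¹) * F * S₀ := by ring

theorem constantCoeff_transfer (θ₀ θ : Param p q) : constantCoeff (transfer θ₀ θ) = 1 := by
  simp only [transfer, rationalPart, map_mul, constantCoeff_inv, constantCoeff_lagPoly,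
    constantCoeff_fracSeries]
  norm_num

/-! ### A contraction that removes the frequency zero -/

/-- The filter `(1 + s)/2 · (1 - z)/(1 - s z)`. Its modulus is at most `1` on the unit disk, it
vanishes at `z = 1`, and it tends to `1` elsewhere as `s → 1`. -/
noncomputable def notch (s : ℝ) : ℝ⟦X⟧ := C ((1 + s) / 2) * ((1 - X) * geomSeries s)

theorem notch_one : notch 1 = 1 := by
  have := one_sub_mul_geomSeries (1 : ℝ)
  rw [map_one, one_mul] at this
  rw [notch, this]; norm_num

/-- The notch filter does not increase the energy. On the unit circle this is the identity
`|1 - s z|² = ((1 + s)/2)² |1 - z|² + ((1 - s)/2)² |1 + z|²`; here it appears as a telescoping sum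
with the stored energy `(1 - s²)/2 · w_n²`, where `w = f/(1 - s z)`. -/
theorem sum_sq_notch_mul_le {s : ℝ} (h0 : 0 ≤ s) (h1 : s ≤ 1) (f : ℝ⟦X⟧) (n : ℕ) :
    ∑ t ∈ Finset.range (n + 1), coeff t (notch s * f) ^ 2 ≤
      ∑ t ∈ Finset.range (n + 1), coeff t f ^ 2 := by
  set w : ℝ⟦X⟧ := geomSeries s * f with hw
  have hf : f = w - C s * (X * w) := by
    rw [hw]; linear_combination -f * one_sub_mul_geomSeries s
  have hy : notch s * f = C ((1 + s) / 2) * (w - X * w) := by rw [hw, notch]; ring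
  suffices h : ∑ t ∈ Finset.range (n + 1), coeff t (notch s * f) ^ 2
      + (1 - s ^ 2) / 2 * coeff n w ^ 2 ≤ ∑ t ∈ Finset.range (n + 1), coeff t f ^ 2 by
    have : 0 ≤ (1 - s ^ 2) / 2 * coeff n w ^ 2 := by
      apply mul_nonneg _ (sq_nonneg _); nlinarith
    linarith
  induction n with
  | zero =>
    have e1 : coeff 0 f = coeff 0 w := by rw [hf]; simp
    have e2 : coeff 0 (notch s * f) = (1 + s) / 2 * coeff 0 w := by rw [hy]; simp
    simp only [zero_add, Finset.sum_range_one]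
    rw [e1, e2]
    nlinarith [sq_nonneg ((1 - s) * coeff 0 w)]
  | succ n ih =>
    have e1 : coeff (n + 1) f = coeff (n + 1) w - s * coeff n w := by
      conv_lhs => rw [hf]
      rw [map_sub, coeff_C_mul, coeff_succ_X_mul]
    have e2 : coeff (n + 1) (notch s * f) = (1 + s) / 2 * (coeff (n + 1) w - coeff n w) := by
      rw [hy, coeff_C_mul, map_sub, coeff_succ_X_mul]
    rw [Finset.sum_range_succ, Finset.sum_range_succ (n := n + 1), e1, e2]
    nlinarith [sq_nonneg ((1 - s) * (coeff (n + 1) w + coeff n w))]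

/-! ### Uniform domination and continuity in the parameter -/

section Domination
variable {δ d₁ d₂ : ℝ} {θ₀ : Param p q}

/-- After the notch filter, the filters that carry the residuals at `θ₀` to those at `θ ∈ Θ_δ` are
dominated by one absolutely summable series: the notch raises the exponent `d - d₀ > -1/2` by one,
which makes the fractional part summable. -/
theorem exists_majorant (hd₁ : -(1 / 2) < d₁) (hd₂ : d₂ < 1 / 2) (hd₀ : -(1 / 2) < d₁ - mem θ₀)
    (hδ : 0 < δ) (hθ₀ : θ₀ ∈ paramSet p q δ d₁ d₂) {s : ℝ} (h0 : 0 ≤ s) (h1 : s < 1) :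
    ∃ M : ℝ⟦X⟧, AbsSummable M ∧
      ∀ θ ∈ paramSet p q δ d₁ d₂, Majorized (notch s * transfer θ₀ θ) M := by
  have hC : ∀ c : ℝ, 0 ≤ c → Majorized (C c : ℝ⟦X⟧) (C c) := by
    intro c hc n
    rw [coeff_C]; split_ifs <;> simp [abs_of_nonneg hc]
  set H : ℝ⟦X⟧ := PowerSeries.mk fun j => 8 * |fracCoeff (1 / 2) j| with hH
  have hHs : AbsSummable H := by
    simpa [AbsSummable, hH] using (summable_abs_fracCoeff_half.mul_left 8)
  have hCs : AbsSummable (C ((1 + s) / 2) : ℝ⟦X⟧) :=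
    summable_of_ne_finset_zero (s := {0}) fun n hn => by
      rw [coeff_C, if_neg (by simpa using hn), norm_zero]
  set g : ℝ⟦X⟧ := geomSeries (1 + δ)⁻¹ with hg
  have hgs : ∀ k, AbsSummable (g ^ k) := absSummable_geomSeries_pow hδ
  refine ⟨C ((1 + s) / 2) * geomSeries s * ((g ^ p * g ^ q) * (g ^ q * g ^ p)) * H,
    ((hCs.mul (absSummable_geomSeries h0 h1)).mul
      (((hgs p).mul (hgs q)).mul ((hgs q).mul (hgs p)))).mul hHs, fun θ hθ => ?_⟩
  have e : notch s * transfer θ₀ θ =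
      C ((1 + s) / 2) * geomSeries s * rationalPart θ₀ θ *
        fracSeries (1 + (mem θ - mem θ₀)) := by
    rw [notch, transfer, ← fracSeries_mul, fracSeries_one]; ring
  rw [e]
  refine (((hC _ (by linarith)).mul (majorized_geomSeries ?_)).mul
    (((majorized_lagPoly hδ hθ.1).mul (majorized_lagPoly_inv hδ hθ.2.1)).mul
      ((majorized_lagPoly hδ hθ₀.2.1).mul (majorized_lagPoly_inv hδ hθ₀.1)))).mul ?_
  · rw [Real.norm_of_nonneg h0]
  · intro j
    rw [fracSeries, coeff_mk, hH, coeff_mk]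
    have hm := hθ.2.2
    have hm₀ := hθ₀.2.2
    exact abs_fracCoeff_le (by linarith [hm.1]) (by linarith [hm.2, hm₀.1]) j

end Domination

/-- A family of power series with continuous coefficients. -/
def CoeffContinuous {T : Type*} [TopologicalSpace T] (f : T → ℝ⟦X⟧) : Prop :=
  ∀ n, Continuous fun θ => coeff n (f θ)

section Continuity
variable {T : Type*} [TopologicalSpace T] {f g : T → ℝ⟦X⟧}

theorem CoeffContinuous.mul (hf : CoeffContinuous f) (hg : CoeffContinuous g) :
    CoeffContinuous fun θ => f θ * g θ := by
  intro n
  simp only [coeff_mul]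
  exact continuous_finsetSum _ fun x _ => (hf _).mul (hg _)

theorem CoeffContinuous.const (F : ℝ⟦X⟧) : CoeffContinuous fun _ : T => F :=
  fun _ => continuous_const

theorem CoeffContinuous.inv (hf : CoeffContinuous f) (h : ∀ θ, constantCoeff (f θ) = 1) :
    CoeffContinuous fun θ => (f θ)⁻¹ := by
  intro n
  induction n using Nat.strong_induction_on with
  | _ n ih =>
    have e : (fun θ => coeff n (f θ)⁻¹) = fun θ => if n = 0 then 1 else
        -1 * ∑ x ∈ Finset.HasAntidiagonal.antidiagonal n,
          if x.2 < n then coeff x.1 (f θ) * coeff x.2 (f θ)⁻¹ else 0 := by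
      funext θ
      rw [coeff_inv, h, inv_one]
    rw [e]
    split_ifs with hn
    · exact continuous_const
    · refine continuous_const.mul (continuous_finsetSum _ fun x _ => ?_)
      split_ifs with hx
      · exact (hf _).mul (ih _ hx)
      · exact continuous_const

end Continuity

theorem continuous_ar (i : Fin p) : Continuous fun θ : Param p q => ar θ i := by
  unfold ar; fun_prop

theorem continuous_ma (j : Fin q) : Continuous fun θ : Param p q => ma θ j := by
  unfold ma; fun_prop

theorem continuous_mem : Continuous fun θ : Param p q => mem θ := by
  unfold mem; fun_prop

theorem coeffContinuous_lagPoly {T : Type*} [TopologicalSpace T] {m : ℕ} {c : T → Fin m → ℝ}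
    (hc : ∀ i, Continuous fun θ => c θ i) : CoeffContinuous fun θ => (lagPoly (c θ) : ℝ⟦X⟧) := by
  intro n
  simp only [Polynomial.coeff_coe, lagPoly, Polynomial.coeff_sub, Polynomial.finsetSum_coeff,
    Polynomial.coeff_C_mul]
  exact continuous_const.sub (continuous_finsetSum _ fun i _ => (hc i).mul continuous_const)

theorem coeffContinuous_fracSeries : CoeffContinuous fracSeries := by
  intro n
  simp only [fracSeries, coeff_mk, fracCoeff]
  fun_prop

theorem coeffContinuous_transfer (θ₀ : Param p q) : CoeffContinuous (transfer θ₀) := by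
  have hF : CoeffContinuous fun θ : Param p q => fracSeries (mem θ - mem θ₀) := fun n =>
    (coeffContinuous_fracSeries n).comp (continuous_mem.sub continuous_const)
  exact (((coeffContinuous_lagPoly continuous_ar).mul
    ((coeffContinuous_lagPoly continuous_ma).inv fun θ => constantCoeff_lagPoly _)).mul
      (.const _)).mul hF

theorem coeffContinuous_notch : CoeffContinuous notch := by
  have h1 : CoeffContinuous fun s : ℝ => (C ((1 + s) / 2) : ℝ⟦X⟧) := by
    intro n
    simp only [coeff_C]
    split_ifs <;> fun_prop
  have h2 : CoeffContinuous fun s : ℝ => geomSeries s := by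
    intro n
    simp only [geomSeries, coeff_mk]
    fun_prop
  exact h1.mul ((CoeffContinuous.const _).mul h2)

/-! ### Identifiability -/

/-- A power `(1 - z)^s` with `|s| < 1` that is a quotient of two nonzero polynomials has `s = 0`:
logarithmic differentiation makes `-s` the difference of the orders of vanishing of numerator and
denominator at `1`. -/
theorem exponent_eq_zero_of_rational {s : ℝ} (hs : |s| < 1) {P Q : Polynomial ℝ} (hP : P ≠ 0)
    (hQ : Q ≠ 0) (h : (P : ℝ⟦X⟧) * fracSeries s = Q) : s = 0 := by
  have hF := fracSeries_deriv s
  have hder : derivative ℝ (Q : ℝ⟦X⟧) =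
      derivative ℝ (P : ℝ⟦X⟧) * fracSeries s + (P : ℝ⟦X⟧) * derivative ℝ (fracSeries s) := by
    rw [← h, Derivation.leibniz, smul_eq_mul, smul_eq_mul]; ring
  have hpoly : (1 - Polynomial.X) * (Q.derivative * P - P.derivative * Q) =
      -(Polynomial.C s * P * Q) := by
    apply Polynomial.coe_injective ℝ
    push_cast
    rw [← derivative_coe, ← derivative_coe, hder, ← h]
    linear_combination (P : ℝ⟦X⟧) * P * hF
  obtain ⟨P₁, hP₁, hP₁'⟩ := Polynomial.exists_eq_pow_rootMultiplicity_mul_and_not_dvd P hP 1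
  obtain ⟨Q₁, hQ₁, hQ₁'⟩ := Polynomial.exists_eq_pow_rootMultiplicity_mul_and_not_dvd Q hQ 1
  set m := P.rootMultiplicity 1
  set l := Q.rootMultiplicity 1
  set Z : Polynomial ℝ := Polynomial.X - Polynomial.C 1 with hZ
  have hZ0 : Z ≠ 0 := Polynomial.X_sub_C_ne_zero 1
  have hdZ : Polynomial.derivative Z = 1 := by simp [hZ]
  -- the derivative of `(z - 1)^k R`, multiplied by `z - 1`
  have hd : ∀ (k : ℕ) (R : Polynomial ℝ), Z * Polynomial.derivative (Z ^ k * R) =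
      Z ^ k * ((k : Polynomial ℝ) * R + Z * Polynomial.derivative R) := by
    intro k R
    rw [Polynomial.derivative_mul, Polynomial.derivative_pow, hdZ]
    cases k with
    | zero => simp
    | succ k => simp; ring
  have hX : (1 - Polynomial.X : Polynomial ℝ) = -Z := by simp [hZ]
  have key : Z ^ (m + l) * (((l : Polynomial ℝ) * Q₁ + Z * Polynomial.derivative Q₁) * P₁ -
      ((m : Polynomial ℝ) * P₁ + Z * Polynomial.derivative P₁) * Q₁) =
      Z ^ (m + l) * (Polynomial.C s * P₁ * Q₁) := by
    have h1 := hd l Q₁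
    have h2 := hd m P₁
    rw [← hQ₁] at h1
    rw [← hP₁] at h2
    rw [hX] at hpoly
    have e : Z * Polynomial.derivative Q * P - Z * Polynomial.derivative P * Q =
        Polynomial.C s * P * Q := by linear_combination -hpoly
    rw [h1, h2] at e
    rw [hP₁, hQ₁] at e
    rw [pow_add]
    linear_combination e
  have key2 := congrArg (Polynomial.eval 1) (mul_left_cancel₀ (pow_ne_zero _ hZ0) key)
  have hp1 : P₁.eval 1 ≠ 0 := fun h0 => hP₁' (Polynomial.dvd_iff_isRoot.2 h0)
  have hq1 : Q₁.eval 1 ≠ 0 := fun h0 => hQ₁' (Polynomial.dvd_iff_isRoot.2 h0)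
  simp [hZ] at key2
  have key3 : ((l : ℝ) - m - s) * (P₁.eval 1 * Q₁.eval 1) = 0 := by linear_combination key2
  have hs' : s = ((l - m : ℤ) : ℝ) := by
    rcases mul_eq_zero.1 key3 with h0 | h0
    · push_cast; linarith
    · exact absurd h0 (mul_ne_zero hp1 hq1)
  rw [hs', ← Int.cast_abs] at hs
  have : |(l - m : ℤ)| < 1 := by exact_mod_cast hs
  rw [hs', Int.abs_lt_one_iff.1 this, Int.cast_zero]

/-- The parameter is identified by its filter: only `θ₀` leaves the residuals unchanged. -/
theorem eq_of_transfer_eq_one {θ₀ θ : Param p q} (hA1 : RootConditions θ₀)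
    (hd : |mem θ - mem θ₀| < 1) (h : transfer θ₀ θ = 1) : θ = θ₀ := by
  have hne : ∀ {m : ℕ} (c : Fin m → ℝ), lagPoly c ≠ 0 := by
    intro m c h0
    have := coeff_zero_lagPoly c
    rw [h0] at this; simp at this
  have hb := lagPoly_mul_inv (ma θ)
  have ha₀ := lagPoly_mul_inv (ar θ₀)
  have hPQ : (((lagPoly (ar θ) * lagPoly (ma θ₀) : Polynomial ℝ)) : ℝ⟦X⟧) *
      fracSeries (mem θ - mem θ₀) = ((lagPoly (ma θ) * lagPoly (ar θ₀) : Polynomial ℝ)) := by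
    push_cast
    rw [transfer, rationalPart] at h
    set A := (lagPoly (ar θ) : ℝ⟦X⟧)
    set B := (lagPoly (ma θ) : ℝ⟦X⟧)
    set A₀ := (lagPoly (ar θ₀) : ℝ⟦X⟧)
    set B₀ := (lagPoly (ma θ₀) : ℝ⟦X⟧)
    set F := fracSeries (mem θ - mem θ₀)
    linear_combination B * A₀ * h - A * B₀ * F * hb - A * B₀ * F * B * B⁻¹ * ha₀
  have hs := exponent_eq_zero_of_rational hd (mul_ne_zero (hne _) (hne _))
    (mul_ne_zero (hne _) (hne _)) hPQ
  rw [hs, fracSeries_zero, mul_one] at hPQ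
  have hpoly : lagPoly (ar θ) * lagPoly (ma θ₀) = lagPoly (ma θ) * lagPoly (ar θ₀) :=
    Polynomial.coe_injective ℝ hPQ
  obtain ⟨k, hk⟩ : lagPoly (ar θ₀) ∣ lagPoly (ar θ) :=
    hA1.coprime.dvd_of_dvd_mul_right ⟨lagPoly (ma θ), by rw [hpoly]; ring⟩
  have hk' : lagPoly (ma θ) = lagPoly (ma θ₀) * k := by
    apply mul_right_cancel₀ (hne (ar θ₀))
    rw [← hpoly, hk]; ring
  have hk0 : k ≠ 0 := by
    rintro rfl; exact hne (ar θ) (by rw [hk, mul_zero])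
  have hdeg : k.natDegree = 0 := by
    have h1 := natDegree_lagPoly_le (ar θ)
    have h2 := natDegree_lagPoly_le (ma θ)
    rw [hk, Polynomial.natDegree_mul (hne _) hk0] at h1
    rw [hk', Polynomial.natDegree_mul (hne _) hk0] at h2
    rcases hA1.order with h | h <;> omega
  have hk1 : k = 1 := by
    have h0 := congrArg (fun P : Polynomial ℝ => P.coeff 0) hk
    simp only [Polynomial.mul_coeff_zero, coeff_zero_lagPoly, one_mul] at h0
    rw [Polynomial.eq_C_of_natDegree_eq_zero hdeg, ← h0, Polynomial.C_1]
  rw [hk1, mul_one] at hk hk'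
  have e1 : ∀ i, ar θ i = ar θ₀ i := fun i => by
    have := coeff_succ_lagPoly (ar θ) i
    rw [hk, coeff_succ_lagPoly] at this; linarith
  have e2 : ∀ i, ma θ i = ma θ₀ i := fun i => by
    have := coeff_succ_lagPoly (ma θ) i
    rw [hk', coeff_succ_lagPoly] at this; linarith
  ext i
  refine Fin.lastCases ?_ (fun i => ?_) i
  · have : mem θ = mem θ₀ := by linarith
    exact this
  · refine Fin.addCases (fun i => e1 i) (fun i => e2 i) i

/-! ### Least squares along one trajectory -/

/-- The lagged sample covariances `(1/n) ∑_{t=1}^n e_{t-j} e_{t-l}`. They are used for sequences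
with `e_0 = 0`, so that the truncated subtraction extends the sequence by zero. -/
noncomputable def lagCov (e : ℕ → ℝ) (n j l : ℕ) : ℝ :=
  (1 / (n : ℝ)) * ∑ t ∈ Finset.Icc 1 n, e (t - j) * e (t - l)

section LagCov
variable {e : ℕ → ℝ}

theorem sum_Icc_eq_sum_range {f : ℕ → ℝ} (hf : f 0 = 0) (n : ℕ) :
    ∑ t ∈ Finset.Icc 1 n, f t = ∑ t ∈ Finset.range (n + 1), f t := by
  refine Finset.sum_subset (fun t ht => ?_) fun t ht ht' => ?_
  · simp only [Finset.mem_Icc, Finset.mem_range] at *; omega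
  · simp only [Finset.mem_Icc, Finset.mem_range] at *
    rw [show t = 0 by omega, hf]

theorem sum_sq_lag_le (h0 : e 0 = 0) (n j : ℕ) :
    ∑ t ∈ Finset.range (n + 1), e (t - j) ^ 2 ≤ ∑ t ∈ Finset.range (n + 1), e t ^ 2 := by
  induction j with
  | zero => simp
  | succ j ih =>
    refine le_trans ?_ ih
    rw [Finset.sum_range_succ', Nat.zero_sub, h0,
      Finset.sum_congr rfl fun t _ => by rw [Nat.add_sub_add_right],
      Finset.sum_range_succ (n := n)]
    nlinarith [sq_nonneg (e (n - j))]

theorem abs_lagCov_le (h0 : e 0 = 0) (n j l : ℕ) : |lagCov e n j l| ≤ lagCov e n 0 0 := by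
  unfold lagCov
  rw [abs_mul, abs_of_nonneg (by positivity)]
  refine mul_le_mul_of_nonneg_left ?_ (by positivity)
  rw [sum_Icc_eq_sum_range (f := fun t => e (t - j) * e (t - l)) (by simp [h0]),
    sum_Icc_eq_sum_range (f := fun t => e (t - 0) * e (t - 0)) (by simp [h0])]
  refine (Finset.abs_sum_le_sum_abs _ _).trans ?_
  have h : ∀ t ∈ Finset.range (n + 1), |e (t - j) * e (t - l)| ≤
      (e (t - j) ^ 2 + e (t - l) ^ 2) / 2 := fun t _ => by
    rw [abs_mul, ← sq_abs (e (t - j)), ← sq_abs (e (t - l))]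
    nlinarith [sq_nonneg (|e (t - j)| - |e (t - l)|)]
  refine (Finset.sum_le_sum h).trans ?_
  rw [← Finset.sum_div, Finset.sum_add_distrib]
  have h1 := sum_sq_lag_le h0 n j
  have h2 := sum_sq_lag_le h0 n l
  simp only [Nat.sub_zero, ← sq]
  linarith

theorem coeff_mul_mk_eq_sum (h0 : e 0 = 0) (G : ℝ⟦X⟧) {t n : ℕ} (ht : t ≤ n) :
    coeff t (G * PowerSeries.mk e) = ∑ j ∈ Finset.range (n + 1), coeff j G * e (t - j) := by
  rw [coeff_mul, Finset.Nat.sum_antidiagonal_eq_sum_range_succ_mk]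
  simp only [coeff_mk]
  refine Finset.sum_subset (Finset.range_mono (by omega)) fun j _ hj => ?_
  rw [Nat.sub_eq_zero_of_le (by simp at hj; omega), h0, mul_zero]

/-- The energy of a filtered sequence is the quadratic form of its sample covariances. -/
theorem mean_sq_mul_eq_tsum (h0 : e 0 = 0) (G : ℝ⟦X⟧) (n : ℕ) :
    (1 / (n : ℝ)) * ∑ t ∈ Finset.Icc 1 n, coeff t (G * PowerSeries.mk e) ^ 2 =
      ∑' x : ℕ × ℕ, coeff x.1 G * coeff x.2 G * lagCov e n x.1 x.2 := by
  rw [tsum_eq_sum (s := Finset.range (n + 1) ×ˢ Finset.range (n + 1)), Finset.sum_product]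
  · have h : ∀ t ∈ Finset.Icc 1 n, coeff t (G * PowerSeries.mk e) ^ 2 =
        ∑ j ∈ Finset.range (n + 1), ∑ l ∈ Finset.range (n + 1),
          coeff j G * coeff l G * (e (t - j) * e (t - l)) := by
      intro t ht
      rw [coeff_mul_mk_eq_sum h0 G (Finset.mem_Icc.1 ht).2, sq, Finset.sum_mul_sum]
      exact Finset.sum_congr rfl fun j _ => Finset.sum_congr rfl fun l _ => by ring
    rw [Finset.sum_congr rfl h, Finset.sum_comm, Finset.mul_sum]
    refine Finset.sum_congr rfl fun j _ => ?_
    rw [Finset.sum_comm, Finset.mul_sum]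
    refine Finset.sum_congr rfl fun l _ => ?_
    rw [lagCov, ← Finset.mul_sum]
    ring
  · rintro ⟨j, l⟩ hx
    have : lagCov e n j l = 0 := by
      unfold lagCov
      rw [Finset.sum_eq_zero, mul_zero]
      intro t ht
      have := (Finset.mem_Icc.1 ht).2
      simp only [Finset.mem_product, Finset.mem_range, not_and_or, not_lt] at hx
      rcases hx with hx | hx
      · rw [Nat.sub_eq_zero_of_le (by omega), h0, zero_mul]
      · rw [Nat.sub_eq_zero_of_le (n := t) (m := l) (by omega), h0, mul_zero]
    simp [this]

/-- If the sample covariances converge to those of a white noise of variance `v`, then a dominated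
and coefficientwise convergent sequence of filters has an output energy that is asymptotically at
least `v` times any partial sum of squares of the limiting coefficients. -/
theorem sum_sq_le_of_tendsto (h0 : e 0 = 0) {n : ℕ → ℕ} {v : ℝ} (hv : 0 < v)
    (hcov : ∀ j l, Tendsto (fun k => lagCov e (n k) j l) atTop (𝓝 (if j = l then v else 0)))
    {G : ℕ → ℝ⟦X⟧} {G' M : ℝ⟦X⟧} (hM : AbsSummable M) (hG : ∀ k, Majorized (G k) M)
    (hlim : ∀ j, Tendsto (fun k => coeff j (G k)) atTop (𝓝 (coeff j G'))) {B : ℕ → ℝ} {b : ℝ}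
    (hB : ∀ k, (1 / (n k : ℝ)) *
      ∑ t ∈ Finset.Icc 1 (n k), coeff t (G k * PowerSeries.mk e) ^ 2 ≤ B k)
    (hb : Tendsto B atTop (𝓝 b)) (J : ℕ) :
    v * ∑ j ∈ Finset.range J, coeff j G' ^ 2 ≤ b := by
  set bound : ℕ × ℕ → ℝ := fun x => ‖coeff x.1 M‖ * ‖coeff x.2 M‖ * (v + 1) with hbound
  have hsum : Summable bound := (Summable.mul_of_nonneg hM hM (fun _ => norm_nonneg _)
    fun _ => norm_nonneg _).mul_right _
  have hcoef : ∀ k j, ‖coeff j (G k)‖ ≤ ‖coeff j M‖ := fun k j =>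
    (hG k j).trans (le_abs_self _)
  have hev : ∀ᶠ k in atTop, lagCov e (n k) 0 0 ≤ v + 1 := by
    have := hcov 0 0
    rw [if_pos rfl] at this
    exact this.eventually_le_const (by linarith)
  have hptw : ∀ x : ℕ × ℕ, Tendsto
      (fun k => coeff x.1 (G k) * coeff x.2 (G k) * lagCov e (n k) x.1 x.2) atTop
      (𝓝 (coeff x.1 G' * coeff x.2 G' * if x.1 = x.2 then v else 0)) := fun x =>
    ((hlim _).mul (hlim _)).mul (hcov _ _)
  have hdom : ∀ᶠ k in atTop, ∀ x : ℕ × ℕ,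
      ‖coeff x.1 (G k) * coeff x.2 (G k) * lagCov e (n k) x.1 x.2‖ ≤ bound x := by
    filter_upwards [hev] with k hk x
    rw [norm_mul, norm_mul]
    refine mul_le_mul (mul_le_mul (hcoef _ _) (hcoef _ _) (norm_nonneg _) (norm_nonneg _))
      ((abs_lagCov_le h0 _ _ _).trans hk) (norm_nonneg _) (by positivity)
  have htends := tendsto_tsum_of_dominated_convergence hsum hptw hdom
  have hle := le_of_tendsto_of_tendsto' htends hb fun k => by
    rw [← mean_sq_mul_eq_tsum h0]; exact hB k
  have hsum' : Summable fun x : ℕ × ℕ =>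
      coeff x.1 G' * coeff x.2 G' * if x.1 = x.2 then v else 0 :=
    hsum.of_norm_bounded fun x =>
      le_of_tendsto (tendsto_norm.comp (hptw x)) (hdom.mono fun k hk => hk x)
  have hnn : ∀ x : ℕ × ℕ, 0 ≤ coeff x.1 G' * coeff x.2 G' * if x.1 = x.2 then v else 0 := by
    rintro ⟨j, l⟩
    dsimp only
    split_ifs with hjl
    · subst hjl; have := mul_self_nonneg (coeff j G'); positivity
    · simp
  refine le_trans ?_ ((hsum'.sum_le_tsum ((Finset.range J).diag) fun x _ => hnn x).trans hle)
  rw [Finset.sum_diag, Finset.mul_sum]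
  exact Finset.sum_le_sum fun j _ => by rw [if_pos rfl]; apply le_of_eq; ring

end LagCov

section Core
variable {δ d₁ d₂ : ℝ} {θ₀ : Param p q}

theorem isBounded_paramSet (hδ : 0 < δ) : Bornology.IsBounded (paramSet p q δ d₁ d₂) := by
  set g : ℝ⟦X⟧ := geomSeries (1 + δ)⁻¹ with hg
  have hbd : ∀ i : Fin (p + q + 1), ∃ K : ℝ, ∀ θ ∈ paramSet p q δ d₁ d₂, |θ i| ≤ K := by
    intro i
    refine Fin.lastCases ?_ (fun i => Fin.addCases (fun i => ?_) (fun i => ?_) i) i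
    · exact ⟨max |d₁| |d₂|, fun θ hθ => abs_le_max_abs_abs hθ.2.2.1 hθ.2.2.2⟩
    · refine ⟨coeff ((i : ℕ) + 1) (g ^ p), fun θ hθ => ?_⟩
      have := majorized_lagPoly hδ hθ.1 ((i : ℕ) + 1)
      rwa [Polynomial.coeff_coe, coeff_succ_lagPoly, norm_neg] at this
    · refine ⟨coeff ((i : ℕ) + 1) (g ^ q), fun θ hθ => ?_⟩
      have := majorized_lagPoly hδ hθ.2.1 ((i : ℕ) + 1)
      rwa [Polynomial.coeff_coe, coeff_succ_lagPoly, norm_neg] at this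
  choose K hK using hbd
  refine isBounded_iff_forall_norm_le.2 ⟨Real.sqrt (∑ i, K i ^ 2), fun θ hθ => ?_⟩
  rw [EuclideanSpace.norm_eq]
  refine Real.sqrt_le_sqrt (Finset.sum_le_sum fun i _ => ?_)
  exact pow_le_pow_left₀ (norm_nonneg _) (hK i θ hθ) 2

theorem lsCriterion_eq_lagCov (n : ℕ) (x : ℤ → ℝ) (θ : Param p q) :
    lsCriterion n x θ = lagCov (lsResidual θ x) n 0 0 := by
  simp [lsCriterion, lagCov, sq]

theorem lsResidual_zero (θ : Param p q) (x : ℤ → ℝ) : lsResidual θ x 0 = 0 := by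
  rw [lsResidual]

/-- Consistency along one trajectory and one sequence of sample sizes: if the sample covariances of
the residuals at `θ₀` converge to those of a white noise, parameters whose criterion does not exceed
that of `θ₀` converge to `θ₀`. -/
theorem tendsto_of_lagCov_tendsto (hd₁ : -(1 / 2) < d₁) (hd₂ : d₂ < 1 / 2)
    (hd₀ : -(1 / 2) < d₁ - mem θ₀) (hδ : 0 < δ) (hθ₀ : θ₀ ∈ paramSet p q δ d₁ d₂)
    (hA1 : RootConditions θ₀) {v : ℝ} (hv : 0 < v) {x : ℤ → ℝ} {n : ℕ → ℕ}
    (hcov : ∀ j l, Tendsto (fun k => lagCov (lsResidual θ₀ x) (n k) j l) atTop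
      (𝓝 (if j = l then v else 0)))
    {θ : ℕ → Param p q} (hθ : ∀ k, θ k ∈ paramSet p q δ d₁ d₂)
    (hmin : ∀ k, lsCriterion (n k) x (θ k) ≤ lsCriterion (n k) x θ₀) :
    Tendsto θ atTop (𝓝 θ₀) := by
  refine tendsto_of_subseq_tendsto fun ns hns => ?_
  obtain ⟨θ', -, φ, hφ, hlim⟩ := tendsto_subseq_of_bounded (isBounded_paramSet hδ)
    (x := fun k => θ (ns k)) fun k => hθ _
  refine ⟨φ, ?_⟩
  suffices h : θ' = θ₀ by rw [← h]; exact hlim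
  have hsub : Tendsto (fun k => ns (φ k)) atTop atTop := hns.comp hφ.tendsto_atTop
  have he0 := lsResidual_zero θ₀ x
  -- the energy of the residuals at `θ₀` gives the upper bound
  have hQ : Tendsto (fun k => lsCriterion (n (ns (φ k))) x θ₀) atTop (𝓝 v) := by
    have := (hcov 0 0).comp hsub
    rw [if_pos rfl] at this
    simpa only [lsCriterion_eq_lagCov, Function.comp_def] using this
  have hcoef : ∀ s : ℝ, ∀ j, Tendsto (fun k => coeff j (notch s * transfer θ₀ (θ (ns (φ k)))))
      atTop (𝓝 (coeff j (notch s * transfer θ₀ θ'))) := fun s j =>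
    ((((CoeffContinuous.const (notch s)).mul (coeffContinuous_transfer θ₀)) j).tendsto θ').comp hlim
  have hnotch : ∀ s : ℝ, 0 ≤ s → s < 1 → ∀ J,
      ∑ j ∈ Finset.range J, coeff j (notch s * transfer θ₀ θ') ^ 2 ≤ 1 := by
    intro s hs0 hs1 J
    obtain ⟨M, hM, hMaj⟩ := exists_majorant hd₁ hd₂ hd₀ hδ hθ₀ hs0 hs1
    have := sum_sq_le_of_tendsto he0 hv (fun j l => (hcov j l).comp hsub) hM
      (fun k => hMaj _ (hθ (ns (φ k)))) (hcoef s) (fun k => ?_) hQ J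
    · exact le_of_mul_le_mul_left (by linarith) hv
    · refine le_trans ?_ (hmin (ns (φ k)))
      rw [lsCriterion]
      refine mul_le_mul_of_nonneg_left ?_ (by positivity)
      have h1 := sum_sq_notch_mul_le hs0 hs1.le (residualSeries (θ (ns (φ k))) x) (n (ns (φ k)))
      rw [residualSeries_eq_transfer_mul θ₀, ← mul_assoc] at h1
      rw [sum_Icc_eq_sum_range (f := fun t => lsResidual (θ (ns (φ k))) x t ^ 2)
        (by simp [lsResidual_zero]),
        sum_Icc_eq_sum_range (f := fun t => coeff t (notch s * transfer θ₀ (θ (ns (φ k))) *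
          PowerSeries.mk (lsResidual θ₀ x)) ^ 2) ?_]
      · refine h1.trans (le_of_eq (Finset.sum_congr rfl fun t _ => ?_))
        rw [← residualSeries_eq_transfer_mul, residualSeries, coeff_mk]
      · simp [he0]
  have hone : ∀ J, ∑ j ∈ Finset.range J, coeff j (transfer θ₀ θ') ^ 2 ≤ 1 := by
    intro J
    have hc : Continuous fun s : ℝ =>
        ∑ j ∈ Finset.range J, coeff j (notch s * transfer θ₀ θ') ^ 2 :=
      continuous_finsetSum _ fun j _ => ((coeffContinuous_notch.mul (.const _)) j).pow 2
    have ht := (hc.tendsto 1).mono_left (nhdsWithin_le_nhds (s := Set.Iio 1))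
    rw [notch_one, one_mul] at ht
    refine le_of_tendsto ht ?_
    filter_upwards [Ioo_mem_nhdsLT (zero_lt_one (α := ℝ))] with s hs
    exact hnotch s hs.1.le hs.2 J
  have htr : transfer θ₀ θ' = 1 := by
    have h0 : coeff 0 (transfer θ₀ θ') = 1 := by
      rw [coeff_zero_eq_constantCoeff_apply, constantCoeff_transfer]
    ext j
    rw [coeff_one]
    split_ifs with hj
    · rw [hj, h0]
    · have h1 := hone (j + 1)
      rw [Finset.sum_range_succ] at h1
      have h2 : coeff 0 (transfer θ₀ θ') ^ 2 ≤
          ∑ i ∈ Finset.range j, coeff i (transfer θ₀ θ') ^ 2 :=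
        Finset.single_le_sum (f := fun i => coeff i (transfer θ₀ θ') ^ 2)
          (fun _ _ => sq_nonneg _) (Finset.mem_range.2 (by omega))
      rw [h0] at h2
      exact pow_eq_zero_iff (two_ne_zero) |>.1 (le_antisymm (by linarith) (sq_nonneg _))
  refine eq_of_transfer_eq_one hA1 ?_ htr
  have hmem : mem θ' ∈ Set.Icc d₁ d₂ := isClosed_Icc.mem_of_tendsto
    ((continuous_mem.tendsto θ').comp hlim) (Eventually.of_forall fun k => (hθ _).2.2)
  have h1 := hθ₀.2.2
  rw [abs_lt]
  constructor <;> linarith [hmem.1, hmem.2, h1.1, h1.2]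

end Core

/-! ### The mean ergodic theorem -/

theorem birkhoffAverage_eq_smul_sum {α : Type*} {T : α → α} (F : α → ℝ) (n : ℕ) :
    birkhoffAverage ℝ T F n = (n : ℝ)⁻¹ • ∑ k ∈ Finset.range n, F ∘ T^[k] := by
  funext x; simp [birkhoffAverage, birkhoffSum]

section Ergodic
variable {α : Type*} [MeasurableSpace α] {μ : Measure α} {T : α → α}

theorem coeFn_birkhoffSum_compMeasurePreserving (hT : MeasurePreserving T μ μ) {F : α → ℝ}
    (hF : MemLp F 2 μ) (n : ℕ) :
    (birkhoffSum (Lp.compMeasurePreserving T hT) id n (hF.toLp F) : Lp ℝ 2 μ) =ᵐ[μ]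
      birkhoffSum T F n := by
  induction n with
  | zero => simpa using Lp.coeFn_zero ℝ 2 μ
  | succ n ih =>
    rw [birkhoffSum_succ]
    have hk : (Lp.compMeasurePreserving T hT)^[n] (hF.toLp F) =ᵐ[μ] F ∘ T^[n] := by
      rw [Lp.compMeasurePreserving_iterate, Lp.toLp_compMeasurePreserving]
      exact MemLp.coeFn_toLp _
    filter_upwards [Lp.coeFn_add (birkhoffSum (Lp.compMeasurePreserving T hT) id n (hF.toLp F))
      (id ((Lp.compMeasurePreserving T hT)^[n] (hF.toLp F))), ih, hk] with x h1 h2 h3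
    rw [h1, Pi.add_apply, h2, id, h3, birkhoffSum_succ]
    rfl

theorem integral_birkhoffAverage (hT : MeasurePreserving T μ μ) {F : α → ℝ} (hF : Integrable F μ)
    {n : ℕ} (hn : n ≠ 0) : ∫ x, birkhoffAverage ℝ T F n x ∂μ = ∫ x, F x ∂μ := by
  have hi : ∀ k, Integrable (fun x => F (T^[k] x)) μ := fun k =>
    (hT.iterate k).integrable_comp_of_integrable hF
  have he : ∀ k, ∫ x, F (T^[k] x) ∂μ = ∫ x, F x ∂μ := fun k => by
    have h := (hT.iterate k)
    rw [← integral_map h.measurable.aemeasurable (by rw [h.map_eq]; exact hF.1), h.map_eq]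
  simp only [birkhoffAverage, birkhoffSum, smul_eq_mul]
  rw [integral_const_mul, integral_finsetSum _ fun k _ => hi k, Finset.sum_congr rfl fun k _ => he k]
  simp [hn]

theorem aestronglyMeasurable_birkhoffAverage (hT : MeasurePreserving T μ μ) {F : α → ℝ}
    (hF : AEStronglyMeasurable F μ) (n : ℕ) :
    AEStronglyMeasurable (birkhoffAverage ℝ T F n) μ := by
  rw [birkhoffAverage_eq_smul_sum]
  exact (Finset.aestronglyMeasurable_sum _ fun k _ =>
    hF.comp_measurePreserving (hT.iterate k)).const_smul _

theorem eLpNorm_birkhoffAverage_le (hT : MeasurePreserving T μ μ) {F : α → ℝ}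
    (hF : AEStronglyMeasurable F μ) (n : ℕ) :
    eLpNorm (birkhoffAverage ℝ T F n) 1 μ ≤ eLpNorm F 1 μ := by
  rw [birkhoffAverage_eq_smul_sum, eLpNorm_const_smul]
  have h1 : eLpNorm (∑ k ∈ Finset.range n, F ∘ T^[k]) 1 μ ≤ n * eLpNorm F 1 μ := by
    refine (eLpNorm_sum_le (fun k _ => hF.comp_measurePreserving (hT.iterate k)) le_rfl).trans ?_
    rw [Finset.sum_congr rfl fun k _ => eLpNorm_comp_measurePreserving hF (hT.iterate k)]
    simp
  refine (mul_le_mul_right h1 _).trans ?_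
  rcases Nat.eq_zero_or_pos n with rfl | hn
  · simp
  · rw [← mul_assoc, enorm_inv (by positivity), Real.enorm_natCast,
      ENNReal.inv_mul_cancel (by simpa using hn.ne') (by simp), one_mul]

variable [IsProbabilityMeasure μ]

/-- The von Neumann mean ergodic theorem for an ergodic transformation, in `L²`. -/
theorem tendsto_eLpNorm_two_birkhoffAverage (hT : Ergodic T μ) {F : α → ℝ} (hF : MemLp F 2 μ) :
    Tendsto (fun n => eLpNorm (fun x => birkhoffAverage ℝ T F n x - ∫ y, F y ∂μ) 2 μ)
      atTop (𝓝 0) := by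
  have hmp := hT.toMeasurePreserving
  set U : Lp ℝ 2 μ →L[ℝ] Lp ℝ 2 μ :=
    (Lp.compMeasurePreservingₗᵢ ℝ T hmp (p := 2) (E := ℝ)).toContinuousLinearMap with hU
  have hU' : (U : Lp ℝ 2 μ → Lp ℝ 2 μ) = Lp.compMeasurePreserving T hmp := rfl
  set f := hF.toLp F
  have hvn := U.tendsto_birkhoffAverage_orthogonalProjection
    (LinearIsometry.norm_toContinuousLinearMap_le _) f
  set g := (U.eqLocus (1 : Lp ℝ 2 μ →L[ℝ] Lp ℝ 2 μ)).orthogonalProjectionOnto f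
  have hg : Lp.compMeasurePreserving T hmp (g : Lp ℝ 2 μ) = g := g.2
  have hg' : (g : Lp ℝ 2 μ) ∘ T =ᵐ[μ] (g : Lp ℝ 2 μ) := by
    have := Lp.coeFn_compMeasurePreserving (g : Lp ℝ 2 μ) hmp
    rw [hg] at this
    exact this.symm
  obtain ⟨c, hc⟩ := hT.ae_eq_const_of_ae_eq_comp_ae (Lp.aestronglyMeasurable _) hg'
  have hconv : Tendsto (fun n => eLpNorm (fun x => birkhoffAverage ℝ T F n x - c) 2 μ)
      atTop (𝓝 0) := by
    rw [Lp.tendsto_Lp_iff_tendsto_eLpNorm'] at hvn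
    refine hvn.congr fun n => eLpNorm_congr_ae ?_
    rw [hU']
    have h1 := coeFn_birkhoffSum_compMeasurePreserving hmp hF n
    have h2 := Lp.coeFn_smul ((n : ℝ)⁻¹)
      (birkhoffSum (Lp.compMeasurePreserving T hmp) id n (hF.toLp F))
    filter_upwards [h1, h2, hc] with x h1 h2 h3
    rw [Pi.sub_apply, h3]
    change (((n : ℝ)⁻¹ • birkhoffSum (Lp.compMeasurePreserving T hmp) id n (hF.toLp F) :
      Lp ℝ 2 μ) : α → ℝ) x - c = _
    rw [h2, Pi.smul_apply, h1]
    rfl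
  have hFi : Integrable F μ := hF.integrable (by norm_num)
  have hmeas : ∀ n, AEStronglyMeasurable (fun x => birkhoffAverage ℝ T F n x - c) μ := fun n =>
    (aestronglyMeasurable_birkhoffAverage hmp hF.1 n).sub aestronglyMeasurable_const
  have hcF : ∫ y, F y ∂μ = c := by
    have hle : ∀ᶠ n : ℕ in atTop, ‖∫ y, F y ∂μ - c‖ₑ ≤
        eLpNorm (fun x => birkhoffAverage ℝ T F n x - c) 2 μ := by
      filter_upwards [eventually_ne_atTop 0] with n hn
      have hint : Integrable (birkhoffAverage ℝ T F n) μ := by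
        rw [birkhoffAverage_eq_smul_sum]
        exact (integrable_finsetSum' _ fun k _ =>
          (hmp.iterate k).integrable_comp_of_integrable hFi).smul _
      have e : ∫ y, F y ∂μ - c = ∫ x, (birkhoffAverage ℝ T F n x - c) ∂μ := by
        rw [integral_sub hint (integrable_const _), integral_birkhoffAverage hmp hFi hn]
        simp
      rw [e]
      refine (enorm_integral_le_lintegral_enorm _).trans ?_
      rw [← eLpNorm_one_eq_lintegral_enorm]
      exact eLpNorm_le_eLpNorm_of_exponent_le (by norm_num) (hmeas n)
    have := le_of_tendsto_of_tendsto tendsto_const_nhds hconv hle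
    have h0 : ‖∫ y, F y ∂μ - c‖ₑ = 0 := le_antisymm this bot_le
    exact sub_eq_zero.1 (enorm_eq_zero.1 h0)
  rw [hcF]
  exact hconv

/-- The mean ergodic theorem in `L¹`, from the one in `L²` by density. -/
theorem tendsto_eLpNorm_one_birkhoffAverage (hT : Ergodic T μ) {F : α → ℝ} (hF : Integrable F μ) :
    Tendsto (fun n => eLpNorm (fun x => birkhoffAverage ℝ T F n x - ∫ y, F y ∂μ) 1 μ)
      atTop (𝓝 0) := by
  have hmp := hT.toMeasurePreserving
  rw [ENNReal.tendsto_nhds_zero]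
  intro η hη
  have hη4 : η / 3 ≠ 0 := by simp [hη.ne']
  obtain ⟨G, hG2, hG⟩ : ∃ G : α → ℝ, MemLp G 2 μ ∧ eLpNorm (F - G) 1 μ < η / 3 := by
    obtain ⟨G, hG, -⟩ := (memLp_one_iff_integrable.2 hF).exists_simpleFunc_eLpNorm_sub_lt
      ENNReal.one_ne_top hη4
    exact ⟨G, G.memLp_of_isFiniteMeasure 2 μ, hG⟩
  have hGi : Integrable G μ := hG2.integrable (by norm_num)
  have hlim := tendsto_eLpNorm_two_birkhoffAverage hT hG2
  rw [ENNReal.tendsto_nhds_zero] at hlim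
  filter_upwards [hlim (η / 3) (by positivity)] with n hn
  have hA : ∀ {H : α → ℝ}, AEStronglyMeasurable H μ →
      AEStronglyMeasurable (birkhoffAverage ℝ T H n) μ :=
    fun h => aestronglyMeasurable_birkhoffAverage hmp h n
  have e : (fun x => birkhoffAverage ℝ T F n x - ∫ y, F y ∂μ) =
      (birkhoffAverage ℝ T (F - G) n + fun x => birkhoffAverage ℝ T G n x - ∫ y, G y ∂μ) +
        fun _ => ∫ y, G y ∂μ - ∫ y, F y ∂μ := by
    funext x
    simp only [Pi.add_apply]
    rw [birkhoffAverage_sub]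
    simp
  rw [e]
  have hc : eLpNorm (fun _ : α => ∫ y, G y ∂μ - ∫ y, F y ∂μ) 1 μ ≤ η / 3 := by
    rw [eLpNorm_const _ one_ne_zero (NeZero.ne μ), ← integral_sub hGi hF]
    simp only [measure_univ, ENNReal.one_rpow, mul_one]
    refine (enorm_integral_le_lintegral_enorm _).trans ?_
    rw [← eLpNorm_one_eq_lintegral_enorm]
    refine le_of_eq_of_le ?_ hG.le
    exact eLpNorm_sub_comm _ _ _ _
  refine (eLpNorm_add_le ((hA (hF.1.sub hGi.1)).add ((hA hGi.1).sub aestronglyMeasurable_const))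
    aestronglyMeasurable_const le_rfl).trans ?_
  refine (add_le_add (eLpNorm_add_le (hA (hF.1.sub hGi.1))
    ((hA hGi.1).sub aestronglyMeasurable_const) le_rfl) hc).trans ?_
  refine (add_le_add (add_le_add ((eLpNorm_birkhoffAverage_le hmp (hF.1.sub hGi.1) n).trans hG.le)
    ((eLpNorm_le_eLpNorm_of_exponent_le (by norm_num)
      ((hA hGi.1).sub aestronglyMeasurable_const)).trans hn)) le_rfl).trans ?_
  rw [ENNReal.add_thirds]

end Ergodic

/-! ### The residuals at the true parameter approximate the noise -/

/-- The convolution of a summable sequence with a null sequence is a null sequence. -/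
theorem tendsto_conv_zero {b a : ℕ → ℝ} (hb : Summable fun j => |b j|)
    (ha : Tendsto a atTop (𝓝 0)) :
    Tendsto (fun t => ∑ j ∈ Finset.range (t + 1), |b j| * a (t - j)) atTop (𝓝 0) := by
  obtain ⟨K, hK⟩ := (Metric.isBounded_range_of_tendsto a ha).exists_norm_le
  have h := tendsto_tsum_of_dominated_convergence (𝓕 := atTop)
    (f := fun t j => if j ≤ t then |b j| * a (t - j) else 0) (g := fun _ => 0)
    (bound := fun j => |b j| * K) (hb.mul_right K) (fun j => ?_) (Eventually.of_forall fun t j => ?_)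
  · rw [tsum_zero] at h
    refine h.congr fun t => ?_
    rw [tsum_eq_sum (s := Finset.range (t + 1)) fun j hj => if_neg (by simp at hj; omega)]
    exact Finset.sum_congr rfl fun j hj => if_pos (by simp at hj; omega)
  · have h1 : Tendsto (fun t => |b j| * a (t - j)) atTop (𝓝 (|b j| * 0)) :=
      (ha.comp (tendsto_sub_atTop_nat j)).const_mul _
    rw [mul_zero] at h1
    refine h1.congr' ?_
    filter_upwards [eventually_ge_atTop j] with t ht
    rw [if_pos ht]
  · have hK0 : 0 ≤ K := (norm_nonneg _).trans (hK _ (Set.mem_range_self 0))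
    split_ifs
    · rw [norm_mul, Real.norm_eq_abs, abs_abs]
      exact mul_le_mul_of_nonneg_left (hK _ (Set.mem_range_self _)) (abs_nonneg _)
    · rw [norm_zero]; positivity

section L2
variable {Ω : Type*} [MeasurableSpace Ω] {P : Measure Ω}

theorem lpNorm_two_sq {Y : Ω → ℝ} (hY : MemLp Y 2 P) : lpNorm Y 2 P ^ 2 = ∫ ω, Y ω * Y ω ∂P := by
  rw [lpNorm_eq_integral_norm_rpow_toReal (by norm_num) (by norm_num) hY.1]
  have h0 : 0 ≤ ∫ ω, ‖Y ω‖ ^ (2 : ENNReal).toReal ∂P := integral_nonneg fun _ => by positivity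
  rw [← Real.rpow_natCast, ← Real.rpow_mul h0]
  simp [← sq]

theorem covariance_eq_integral_mul {Y Z : Ω → ℝ} (hY : ∫ ω, Y ω ∂P = 0) (hZ : ∫ ω, Z ω ∂P = 0) :
    covariance Y Z P = ∫ ω, Y ω * Z ω ∂P := by
  simp [covariance, hY, hZ]

/-- Cauchy–Schwarz. -/
theorem integral_abs_mul_le {Y Z : Ω → ℝ} (hY : MemLp Y 2 P) (hZ : MemLp Z 2 P) :
    ∫ ω, |Y ω * Z ω| ∂P ≤ lpNorm Y 2 P * lpNorm Z 2 P := by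
  have h := integral_mul_norm_le_Lp_mul_Lq (μ := P) (f := Y) (g := Z) (p := 2) (q := 2)
    Real.HolderConjugate.two_two (by simpa using hY) (by simpa using hZ)
  rw [lpNorm_eq_integral_norm_rpow_toReal (by norm_num) (by norm_num) hY.1,
    lpNorm_eq_integral_norm_rpow_toReal (by norm_num) (by norm_num) hZ.1]
  simpa [abs_mul] using h

variable {X : ℤ → Ω → ℝ}

theorem memLp_linearComb (hX : ∀ t, MemLp (X t) 2 P) {ι : Type*} (s : Finset ι) (c : ι → ℝ)
    (f : ι → ℤ) : MemLp (fun ω => ∑ j ∈ s, c j * X (f j) ω) 2 P :=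
  memLp_finsetSum _ fun _ _ => (hX _).const_mul _

variable [IsProbabilityMeasure P]

/-- Linear combinations of a stationary process have a norm that does not depend on time. -/
theorem IsCenteredStationary.lpNorm_shift (hX : IsCenteredStationary P X) (s : Finset ℕ)
    (c : ℕ → ℝ) (t : ℤ) :
    lpNorm (fun ω => ∑ j ∈ s, c j * X (t - j) ω) 2 P =
      lpNorm (fun ω => ∑ j ∈ s, c j * X (0 - j) ω) 2 P := by
  have hsq : ∀ u : ℤ, lpNorm (fun ω => ∑ j ∈ s, c j * X (u - j) ω) 2 P ^ 2 =
      ∑ j ∈ s, ∑ k ∈ s, c j * (c k * covariance (X (0 - j)) (X (0 - k)) P) := by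
    intro u
    have hm : ∫ ω, ∑ j ∈ s, c j * X (u - j) ω ∂P = 0 := by
      rw [integral_finsetSum _ fun j _ => ((hX.memLp _).integrable (by norm_num)).const_mul _]
      exact Finset.sum_eq_zero fun j _ => by rw [integral_const_mul, hX.mean, mul_zero]
    rw [lpNorm_two_sq (memLp_linearComb hX.memLp s c _), ← covariance_eq_integral_mul hm hm,
      covariance_fun_sum_fun_sum' (fun j _ => (hX.memLp _).const_mul _)
        (fun j _ => (hX.memLp _).const_mul _)]
    refine Finset.sum_congr rfl fun j _ => Finset.sum_congr rfl fun k _ => ?_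
    rw [covariance_const_mul_left, covariance_const_mul_right]
    have := hX.cov (u - j) (0 - j) (j - k)
    rw [show u - j + (j - k) = u - k by ring, show (0 : ℤ) - j + (j - k) = 0 - k by ring] at this
    rw [this]
  exact (pow_left_inj₀ lpNorm_nonneg lpNorm_nonneg two_ne_zero).1 ((hsq t).trans (hsq 0).symm)

/-- If the series `∑_j c_j X_{t-j}` converges in `L²` for every `t`, the norm of its remainders is
bounded by the one at time `0`. -/
theorem IsCenteredStationary.lpNorm_remainder_le (hX : IsCenteredStationary P X) {c : ℕ → ℝ}
    {U : ℤ → Ω → ℝ} (hU : ∀ t, MemLp (U t) 2 P)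
    (hlim : ∀ t : ℤ, Tendsto (fun N : ℕ =>
      lpNorm (fun ω => ∑ j ∈ Finset.range N, c j * X (t - j) ω - U t ω) 2 P) atTop (𝓝 0))
    (t : ℤ) (N : ℕ) :
    lpNorm (fun ω => ∑ j ∈ Finset.range N, c j * X (t - j) ω - U t ω) 2 P ≤
      lpNorm (fun ω => ∑ j ∈ Finset.range N, c j * X (0 - j) ω - U 0 ω) 2 P := by
  set S : ℕ → ℤ → Ω → ℝ := fun M u ω => ∑ j ∈ Finset.range M, c j * X (u - j) ω with hS
  have hSm : ∀ M u, MemLp (S M u) 2 P := fun M u => memLp_linearComb hX.memLp _ _ _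
  have h12 : (1 : ENNReal) ≤ 2 := by norm_num
  have hdiff : ∀ M, N ≤ M → lpNorm (S N t - S M t) 2 P = lpNorm (S N 0 - S M 0) 2 P := by
    intro M hM
    have e : ∀ u, S N u - S M u =
        -fun ω => ∑ j ∈ Finset.range M \ Finset.range N, c j * X (u - j) ω := by
      intro u
      funext ω
      simp only [Pi.sub_apply, Pi.neg_apply, hS]
      rw [← Finset.sum_sdiff (Finset.range_mono hM)]
      ring
    rw [e, e, lpNorm_neg, lpNorm_neg, hX.lpNorm_shift]
  have hbd : ∀ M, N ≤ M → lpNorm (S N t - U t) 2 P ≤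
      (lpNorm (S N 0 - U 0) 2 P + lpNorm (S M 0 - U 0) 2 P) + lpNorm (S M t - U t) 2 P := by
    intro M hM
    refine (lpNorm_sub_le_lpNorm_sub_add_lpNorm_sub (g := S M t) (hSm N t) (hSm M t) h12).trans ?_
    rw [hdiff M hM, lpNorm_sub_comm (S M 0)]
    gcongr
    exact lpNorm_sub_le_lpNorm_sub_add_lpNorm_sub (hSm N 0) (hU 0) h12
  have hl := ((tendsto_const_nhds (x := lpNorm (S N 0 - U 0) 2 P)).add (hlim 0)).add (hlim t)
  rw [add_zero, add_zero] at hl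
  exact ge_of_tendsto hl ((eventually_ge_atTop N).mono hbd)

end L2

section NoiseApproximation
variable {Ω : Type*} [MeasurableSpace Ω] {P : Measure Ω}
variable {X ε : ℤ → Ω → ℝ}

theorem lpNorm_sum_mul_le {ι : Type*} (s : Finset ι) (c : ι → ℝ) {f : ι → Ω → ℝ}
    (hf : ∀ i, MemLp (f i) 2 P) :
    lpNorm (fun ω => ∑ i ∈ s, c i * f i ω) 2 P ≤ ∑ i ∈ s, |c i| * lpNorm (f i) 2 P := by
  have e : (fun ω => ∑ i ∈ s, c i * f i ω) = ∑ i ∈ s, c i • f i := by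
    funext ω; simp
  rw [e]
  refine (lpNorm_sum_le (fun i _ => (hf i).const_smul _) (by norm_num)).trans (le_of_eq ?_)
  exact Finset.sum_congr rfl fun i _ => by rw [lpNorm_const_smul]; rfl

theorem memLp_lsResidual (hX : ∀ t, MemLp (X t) 2 P) (θ : Param p q) (t : ℕ) :
    MemLp (fun ω => lsResidual θ (fun s => X s ω) t) 2 P := by
  set γ := (lagPoly (ma θ) : ℝ⟦X⟧)⁻¹ * ((lagPoly (ar θ) : ℝ⟦X⟧) * fracSeries (mem θ)) with hγ
  have e : (fun ω => lsResidual θ (fun s => X s ω) t) = fun ω =>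
      ∑ x ∈ Finset.HasAntidiagonal.antidiagonal t,
        coeff x.1 γ * if x.2 = 0 then 0 else X x.2 ω := by
    funext ω
    have h := ma_mul_residualSeries θ (fun s => X s ω)
    have hb := lagPoly_mul_inv (ma θ)
    have h' : residualSeries θ (fun s => X s ω) = γ * pathSeries (fun s => X s ω) := by
      rw [hγ]
      linear_combination (lagPoly (ma θ) : ℝ⟦X⟧)⁻¹ * h - residualSeries θ (fun s => X s ω) * hb
    have h'' := congrArg (coeff t) h'
    rw [coeff_mul] at h''
    simpa [residualSeries, pathSeries] using h''
  rw [e]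
  refine memLp_finsetSum _ fun x _ => ?_
  split_ifs
  · simp
  · exact (hX _).const_mul _

/-- The deviation `ε̃_t(θ) - ε_t` of the residuals from the noise, set to zero at `t = 0`. -/
noncomputable def deviation (θ : Param p q) (X ε : ℤ → Ω → ℝ) (t : ℕ) (ω : Ω) : ℝ :=
  if t = 0 then 0 else lsResidual θ (fun s => X s ω) t - ε t ω

theorem memLp_deviation (hX : ∀ t, MemLp (X t) 2 P) (hε : ∀ t, MemLp (ε t) 2 P) (θ : Param p q)
    (t : ℕ) : MemLp (deviation θ X ε t) 2 P := by
  by_cases ht : t = 0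
  · have : deviation θ X ε t = 0 := by funext ω; simp [deviation, ht]
    rw [this]; exact MemLp.zero
  · have : deviation θ X ε t = (fun ω => lsResidual θ (fun s => X s ω) t) - ε t := by
      funext ω; simp [deviation, ht]
    rw [this]; exact (memLp_lsResidual hX θ t).sub (hε t)

/-- The moving average polynomial applied to the deviations. -/
noncomputable def maDeviation (θ : Param p q) (X ε : ℤ → Ω → ℝ) (t : ℕ) (ω : Ω) : ℝ :=
  deviation θ X ε t ω - ∑ j : Fin q, ma θ j * deviation θ X ε (t - ((j : ℕ) + 1)) ω

theorem memLp_maDeviation (hX : ∀ t, MemLp (X t) 2 P) (hε : ∀ t, MemLp (ε t) 2 P) (θ : Param p q)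
    (t : ℕ) : MemLp (maDeviation θ X ε t) 2 P :=
  (memLp_deviation hX hε θ t).sub
    (memLp_finsetSum _ fun _ _ => (memLp_deviation hX hε θ _).const_mul _)

/-- The deviations are recovered by inverting the moving average polynomial. -/
theorem deviation_eq_sum {Ω : Type*} {X ε : ℤ → Ω → ℝ} (θ : Param p q) (t : ℕ) (ω : Ω) :
    deviation θ X ε t ω = ∑ j ∈ Finset.range (t + 1),
      coeff j (lagPoly (ma θ) : ℝ⟦X⟧)⁻¹ * maDeviation θ X ε (t - j) ω := by
  set R : ℝ⟦X⟧ := PowerSeries.mk fun t => deviation θ X ε t ω with hR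
  have h0 : coeff 0 R = 0 := by simp [hR, deviation]
  have hw : (lagPoly (ma θ) : ℝ⟦X⟧) * R = PowerSeries.mk fun t => maDeviation θ X ε t ω := by
    ext t
    rw [coeff_lagPoly_mul _ h0]
    simp [hR, maDeviation]
  have hb := lagPoly_mul_inv (ma θ)
  have h : R = (lagPoly (ma θ) : ℝ⟦X⟧)⁻¹ * PowerSeries.mk fun t => maDeviation θ X ε t ω := by
    rw [← hw]; linear_combination -R * hb
  have h' := congrArg (coeff t) h
  rw [coeff_mul, Finset.Nat.sum_antidiagonal_eq_sum_range_succ_mk] at h'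
  simpa [hR] using h'

theorem maDeviation_ae_eq {θ : Param p q} {U : ℤ → Ω → ℝ}
    (hU : ∀ t : ℤ, ∀ᵐ ω ∂P,
      U t ω - ∑ i : Fin p, ar θ i * U (t - (((i : ℕ) : ℤ) + 1)) ω =
        ε t ω - ∑ j : Fin q, ma θ j * ε (t - (((j : ℕ) : ℤ) + 1)) ω)
    {t : ℕ} (ht : p + q < t) :
    maDeviation θ X ε t =ᵐ[P]
      (fun ω => truncDiff (mem θ) (fun s => X s ω) t - U t ω) -
        fun ω => ∑ i : Fin p, ar θ i * (truncDiff (mem θ) (fun s => X s ω) (t - ((i : ℕ) + 1)) -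
          U ((t - ((i : ℕ) + 1) : ℕ) : ℤ) ω) := by
  filter_upwards [hU t] with ω hω
  obtain ⟨t, rfl⟩ : ∃ u, t = u + 1 := ⟨t - 1, by omega⟩
  have hrec : lsResidual θ (fun s => X s ω) (t + 1) =
      truncDiff (mem θ) (fun s => X s ω) (t + 1)
        - ∑ i : Fin p, ar θ i * truncDiff (mem θ) (fun s => X s ω) (t + 1 - ((i : ℕ) + 1))
        + ∑ j : Fin q, ma θ j * lsResidual θ (fun s => X s ω) (t + 1 - ((j : ℕ) + 1)) := by
    rw [lsResidual]
  have e1 : ∀ j : Fin q, deviation θ X ε (t + 1 - ((j : ℕ) + 1)) ω =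
      lsResidual θ (fun s => X s ω) (t + 1 - ((j : ℕ) + 1)) -
        ε (((t + 1 : ℕ) : ℤ) - (((j : ℕ) : ℤ) + 1)) ω := by
    intro j
    have := j.2
    rw [deviation, if_neg (by omega)]
    congr 3
    omega
  have e2 : ∀ i : Fin p, (((t + 1 - ((i : ℕ) + 1) : ℕ)) : ℤ) =
      ((t + 1 : ℕ) : ℤ) - (((i : ℕ) : ℤ) + 1) := by
    intro i
    have := i.2
    omega
  simp only [maDeviation, Pi.sub_apply, e1, e2]
  rw [deviation, if_neg (by omega), hrec]
  simp only [mul_sub, Finset.sum_sub_distrib]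
  linarith

variable [IsProbabilityMeasure P] in
/-- The residuals at the true parameter approximate the noise in `L²`. -/
theorem tendsto_lpNorm_deviation {δ d₁ d₂ v : ℝ} {θ₀ : Param p q} (hδ : 0 < δ)
    (hθ₀ : θ₀ ∈ paramSet p q δ d₁ d₂) (hX : IsCenteredStationary P X) (hXε : IsFarima P θ₀ X ε)
    (hA0 : IsWeakWhiteNoise P ε v) :
    Tendsto (fun t => lpNorm (deviation θ₀ X ε t) 2 P) atTop (𝓝 0) := by
  obtain ⟨U, hU, hlim, heq⟩ := hXε
  have hlim' : ∀ t : ℤ, Tendsto (fun N : ℕ => lpNorm (fun ω =>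
      ∑ j ∈ Finset.range N, fracCoeff (mem θ₀) j * X (t - j) ω - U t ω) 2 P) atTop (𝓝 0) := by
    intro t
    have h := (ENNReal.tendsto_toReal ENNReal.zero_ne_top).comp (hlim t)
    refine h.congr fun N => ?_
    exact toReal_eLpNorm ((memLp_linearComb hX.memLp _ _ _).sub (hU t)).1
  have hu : Tendsto (fun t : ℕ => lpNorm (fun ω =>
      truncDiff (mem θ₀) (fun s => X s ω) t - U t ω) 2 P) atTop (𝓝 0) :=
    squeeze_zero (fun _ => lpNorm_nonneg)
      (fun t => hX.lpNorm_remainder_le hU hlim' (t : ℤ) t) (hlim' 0)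
  have hum : ∀ t : ℕ, MemLp (fun ω => truncDiff (mem θ₀) (fun s => X s ω) t - U t ω) 2 P :=
    fun t => (memLp_linearComb hX.memLp _ _ _).sub (hU t)
  have hw : Tendsto (fun t => lpNorm (maDeviation θ₀ X ε t) 2 P) atTop (𝓝 0) := by
    have hb : Tendsto (fun t : ℕ => lpNorm (fun ω =>
        truncDiff (mem θ₀) (fun s => X s ω) t - U t ω) 2 P + ∑ i : Fin p, |ar θ₀ i| *
          lpNorm (fun ω => truncDiff (mem θ₀) (fun s => X s ω) (t - ((i : ℕ) + 1)) -
            U ((t - ((i : ℕ) + 1) : ℕ) : ℤ) ω) 2 P) atTop (𝓝 (0 + ∑ i : Fin p, |ar θ₀ i| * 0)) :=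
      hu.add (tendsto_finsetSum _ fun i _ => (hu.comp (tendsto_sub_atTop_nat _)).const_mul _)
    simp only [mul_zero, Finset.sum_const_zero, add_zero] at hb
    refine squeeze_zero' (Eventually.of_forall fun _ => lpNorm_nonneg) ?_ hb
    filter_upwards [eventually_gt_atTop (p + q)] with t ht
    have hae := maDeviation_ae_eq (X := X) heq ht
    rw [← toReal_eLpNorm (memLp_maDeviation hX.memLp hA0.memLp θ₀ t).1, eLpNorm_congr_ae hae,
      toReal_eLpNorm ((hum t).sub (memLp_finsetSum _ fun i _ => (hum _).const_mul _)).1]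
    refine (lpNorm_sub_le (hum t) (by norm_num)).trans ?_
    gcongr
    exact lpNorm_sum_mul_le _ _ fun i => hum _
  refine squeeze_zero (fun _ => lpNorm_nonneg) (fun t => ?_) (tendsto_conv_zero
    (b := fun j => coeff j (lagPoly (ma θ₀) : ℝ⟦X⟧)⁻¹)
    ((absSummable_geomSeries_pow hδ q).of_majorized (majorized_lagPoly_inv hδ hθ₀.2.1)) hw)
  have e : deviation θ₀ X ε t = fun ω => ∑ j ∈ Finset.range (t + 1),
      coeff j (lagPoly (ma θ₀) : ℝ⟦X⟧)⁻¹ * maDeviation θ₀ X ε (t - j) ω := by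
    funext ω; exact deviation_eq_sum θ₀ t ω
  rw [e]
  exact lpNorm_sum_mul_le _ _ fun j => memLp_maDeviation hX.memLp hA0.memLp θ₀ _

end NoiseApproximation

/-! ### Convergence of the sample covariances -/

section Covariances
variable {Ω : Type*} [MeasurableSpace Ω] {P : Measure Ω}
variable {X ε : ℤ → Ω → ℝ}

theorem IsWeakWhiteNoise.integral_mul {v : ℝ} (h : IsWeakWhiteNoise P ε v) (s t : ℤ) :
    ∫ ω, ε s ω * ε t ω ∂P = if s = t then v else 0 := by
  rw [← covariance_eq_integral_mul (h.mean s) (h.mean t)]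
  split_ifs with hst
  · rw [hst, covariance_self (h.memLp t).aemeasurable, h.var]
  · have := h.cov s (t - s) (by omega)
    rwa [add_sub_cancel] at this

theorem IsWeakWhiteNoise.lpNorm_eq {v : ℝ} (h : IsWeakWhiteNoise P ε v) (t : ℤ) :
    lpNorm (ε t) 2 P = Real.sqrt v := by
  rw [← Real.sqrt_sq (lpNorm_nonneg (f := ε t)), lpNorm_two_sq (h.memLp t), h.integral_mul, if_pos rfl]

theorem iterate_shift (k : ℕ) (x : ℤ → ℝ) (t : ℤ) :
    (fun (x : ℤ → ℝ) (t : ℤ) => x (t + 1))^[k] x t = x (t + k) := by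
  induction k generalizing x with
  | zero => simp
  | succ k ih =>
    rw [Function.iterate_succ_apply, ih]
    congr 1; push_cast; ring

variable [IsProbabilityMeasure P] in
/-- The ergodic theorem for the lagged products of the noise. -/
theorem tendsto_noise_covariance {v : ℝ} (hA0 : IsWeakWhiteNoise P ε v)
    (hA2 : IsStationaryErgodic P ε) (j l : ℕ) :
    Tendsto (fun n : ℕ => ∫ ω, |(n : ℝ)⁻¹ * ∑ k ∈ Finset.range n,
      ε (((k + 1 : ℕ) : ℤ) - j) ω * ε (((k + 1 : ℕ) : ℤ) - l) ω - if j = l then v else 0| ∂P)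
      atTop (𝓝 0) := by
  set path : Ω → ℤ → ℝ := fun ω t => ε t ω with hpath
  have hpm : AEMeasurable path P := aemeasurable_pi_lambda _ fun t => (hA0.memLp t).aemeasurable
  set F : (ℤ → ℝ) → ℝ := fun x => x (1 - j) * x (1 - l) with hF
  have hFm : Measurable F := (measurable_pi_apply _).mul (measurable_pi_apply _)
  have : IsProbabilityMeasure (P.map path) := Measure.isProbabilityMeasure_map hpm
  have hFi : Integrable F (P.map path) := by
    rw [integrable_map_measure hFm.aestronglyMeasurable hpm]
    exact (hA0.memLp (1 - j)).integrable_mul (hA0.memLp (1 - l))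
  have hFint : ∫ x, F x ∂(P.map path) = if j = l then v else 0 := by
    rw [integral_map hpm hFm.aestronglyMeasurable]
    simp only [hF, hpath]
    rw [hA0.integral_mul]
    congr 1
    simp
  have h := tendsto_eLpNorm_one_birkhoffAverage hA2 hFi
  have h' := (ENNReal.tendsto_toReal ENNReal.zero_ne_top).comp h
  refine h'.congr fun n => ?_
  set A : (ℤ → ℝ) → ℝ := fun x =>
    birkhoffAverage ℝ (fun (x : ℤ → ℝ) (t : ℤ) => x (t + 1)) F n x - ∫ x, F x ∂(P.map path)
    with hA
  have hm : AEStronglyMeasurable A (P.map path) :=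
    (aestronglyMeasurable_birkhoffAverage hA2.toMeasurePreserving hFi.1 n).sub
      aestronglyMeasurable_const
  have e : A ∘ path = fun ω => (n : ℝ)⁻¹ * ∑ k ∈ Finset.range n,
      ε (((k + 1 : ℕ) : ℤ) - j) ω * ε (((k + 1 : ℕ) : ℤ) - l) ω - if j = l then v else 0 := by
    funext ω
    simp only [hA, Function.comp, hFint, birkhoffAverage, birkhoffSum, smul_eq_mul]
    simp only [hF, iterate_shift, hpath]
    congr 2
    refine Finset.sum_congr rfl fun k _ => ?_
    rw [show (1 : ℤ) - j + k = ((k + 1 : ℕ) : ℤ) - j by push_cast; ring,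
      show (1 : ℤ) - l + k = ((k + 1 : ℕ) : ℤ) - l by push_cast; ring]
  have hm' := hm.comp_aemeasurable hpm
  change (eLpNorm A 1 (P.map path)).toReal = _
  rw [eLpNorm_map_measure hm hpm, toReal_eLpNorm hm', lpNorm_one_eq_integral_norm hm', e]
  rfl

theorem sum_Icc_one_eq_sum_range (f : ℕ → ℝ) (n : ℕ) :
    ∑ t ∈ Finset.Icc 1 n, f t = ∑ k ∈ Finset.range n, f (k + 1) := by
  induction n with
  | zero => simp
  | succ n ih => rw [Finset.sum_Icc_succ_top (by omega), ih, Finset.sum_range_succ]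

/-- The lagged products of the residuals at the true parameter are close in mean to those of the
noise. -/
theorem tendsto_integral_lagged_product {v : ℝ} {θ : Param p q} (hX : ∀ t, MemLp (X t) 2 P)
    (hA0 : IsWeakWhiteNoise P ε v)
    (hr : Tendsto (fun t => lpNorm (deviation θ X ε t) 2 P) atTop (𝓝 0)) (j l : ℕ) :
    Tendsto (fun t : ℕ => ∫ ω, |lsResidual θ (fun s => X s ω) (t - j) *
      lsResidual θ (fun s => X s ω) (t - l) - ε ((t : ℤ) - j) ω * ε ((t : ℤ) - l) ω| ∂P)
      atTop (𝓝 0) := by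
  have hrm := memLp_deviation (P := P) hX hA0.memLp θ
  have hlag : ∀ i : ℕ, Tendsto (fun t => lpNorm (deviation θ X ε (t - i)) 2 P) atTop (𝓝 0) :=
    fun i => hr.comp (tendsto_sub_atTop_nat i)
  have hb : Tendsto (fun t : ℕ => lpNorm (deviation θ X ε (t - j)) 2 P *
      lpNorm (deviation θ X ε (t - l)) 2 P + lpNorm (deviation θ X ε (t - j)) 2 P * Real.sqrt v +
      Real.sqrt v * lpNorm (deviation θ X ε (t - l)) 2 P) atTop
      (𝓝 (0 * 0 + 0 * Real.sqrt v + Real.sqrt v * 0)) :=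
    (((hlag j).mul (hlag l)).add ((hlag j).mul_const _)).add ((hlag l).const_mul _)
  simp only [mul_zero, zero_mul, add_zero] at hb
  refine squeeze_zero' (Eventually.of_forall fun _ => integral_nonneg fun _ => abs_nonneg _) ?_ hb
  filter_upwards [eventually_gt_atTop (j + l)] with t ht
  have hres : ∀ i : ℕ, i < t → ∀ ω, lsResidual θ (fun s => X s ω) (t - i) =
      deviation θ X ε (t - i) ω + ε ((t : ℤ) - i) ω := by
    intro i hi ω
    rw [deviation, if_neg (by omega), Nat.cast_sub hi.le]
    ring
  have hi1 := ((hrm (t - j)).integrable_mul (hrm (t - l))).abs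
  have hi2 := ((hrm (t - j)).integrable_mul (hA0.memLp ((t : ℤ) - l))).abs
  have hi3 := ((hA0.memLp ((t : ℤ) - j)).integrable_mul (hrm (t - l))).abs
  calc _ ≤ ∫ ω, (|deviation θ X ε (t - j) ω * deviation θ X ε (t - l) ω| +
          |deviation θ X ε (t - j) ω * ε ((t : ℤ) - l) ω| +
          |ε ((t : ℤ) - j) ω * deviation θ X ε (t - l) ω|) ∂P := by
        refine integral_mono_of_nonneg (Eventually.of_forall fun _ => abs_nonneg _)
          ((hi1.add hi2).add hi3) (Eventually.of_forall fun ω => ?_)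
        dsimp only
        rw [hres j (by omega), hres l (by omega)]
        refine le_trans (le_of_eq ?_) (abs_add_three _ _ _)
        congr 1; ring
    _ = (∫ ω, |deviation θ X ε (t - j) ω * deviation θ X ε (t - l) ω| ∂P) +
          (∫ ω, |deviation θ X ε (t - j) ω * ε ((t : ℤ) - l) ω| ∂P) +
          ∫ ω, |ε ((t : ℤ) - j) ω * deviation θ X ε (t - l) ω| ∂P := by
        exact (integral_add (hi1.add hi2) hi3).trans (congrArg (· + _) (integral_add hi1 hi2))
    _ ≤ _ := by
        have h1 := integral_abs_mul_le (hrm (t - j)) (hrm (t - l))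
        have h2 := integral_abs_mul_le (hrm (t - j)) (hA0.memLp ((t : ℤ) - l))
        have h3 := integral_abs_mul_le (hA0.memLp ((t : ℤ) - j)) (hrm (t - l))
        rw [hA0.lpNorm_eq] at h2 h3
        linarith

variable [IsProbabilityMeasure P] in
/-- The sample covariances of the residuals at the true parameter converge in mean to those of a
white noise of variance `v`. -/
theorem tendsto_integral_lagCov {v : ℝ} {θ : Param p q} (hX : ∀ t, MemLp (X t) 2 P)
    (hA0 : IsWeakWhiteNoise P ε v) (hA2 : IsStationaryErgodic P ε)
    (hr : Tendsto (fun t => lpNorm (deviation θ X ε t) 2 P) atTop (𝓝 0)) (j l : ℕ) :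
    Tendsto (fun n : ℕ => ∫ ω, |lagCov (lsResidual θ (fun s => X s ω)) n j l -
      if j = l then v else 0| ∂P) atTop (𝓝 0) := by
  set c : ℝ := if j = l then v else 0
  set D : ℕ → Ω → ℝ := fun t ω => lsResidual θ (fun s => X s ω) (t - j) *
      lsResidual θ (fun s => X s ω) (t - l) - ε ((t : ℤ) - j) ω * ε ((t : ℤ) - l) ω with hD
  set N : ℕ → Ω → ℝ := fun n ω => (n : ℝ)⁻¹ * ∑ k ∈ Finset.range n,
      ε (((k + 1 : ℕ) : ℤ) - j) ω * ε (((k + 1 : ℕ) : ℤ) - l) ω - c with hN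
  have hDi : ∀ t, Integrable (D t) P := fun t =>
    ((memLp_lsResidual hX θ _).integrable_mul (memLp_lsResidual hX θ _)).sub
      ((hA0.memLp _).integrable_mul (hA0.memLp _))
  have hNi : ∀ n, Integrable (N n) P := fun n =>
    ((integrable_finsetSum _ fun k _ =>
      (hA0.memLp (((k + 1 : ℕ) : ℤ) - j)).integrable_mul
        (hA0.memLp (((k + 1 : ℕ) : ℤ) - l))).const_mul _).sub (integrable_const _)
  have hces := ((tendsto_integral_lagged_product hX hA0 hr j l).comp
    (tendsto_add_atTop_nat 1)).cesaro
  have hsum := hces.add (tendsto_noise_covariance hA0 hA2 j l)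
  rw [add_zero] at hsum
  refine squeeze_zero (fun _ => integral_nonneg fun _ => abs_nonneg _) (fun n => ?_) hsum
  have hsplit : ∀ ω, lagCov (lsResidual θ (fun s => X s ω)) n j l - c =
      (n : ℝ)⁻¹ * ∑ k ∈ Finset.range n, D (k + 1) ω + N n ω := by
    intro ω
    rw [lagCov, sum_Icc_one_eq_sum_range]
    simp only [hD, hN, Finset.sum_sub_distrib]
    ring
  have hDa : ∀ k, Integrable (fun ω => |D (k + 1) ω|) P := fun k => (hDi _).abs
  have hDs : Integrable (fun ω => (n : ℝ)⁻¹ * ∑ k ∈ Finset.range n, |D (k + 1) ω|) P :=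
    (integrable_finsetSum _ fun k _ => hDa k).const_mul _
  calc _ ≤ ∫ ω, ((n : ℝ)⁻¹ * ∑ k ∈ Finset.range n, |D (k + 1) ω| + |N n ω|) ∂P := by
        refine integral_mono_of_nonneg (Eventually.of_forall fun _ => abs_nonneg _)
          (hDs.add (hNi n).abs) (Eventually.of_forall fun ω => ?_)
        dsimp only
        rw [hsplit]
        refine (abs_add_le _ _).trans (add_le_add_left ?_ _)
        rw [abs_mul, abs_of_nonneg (by positivity)]
        exact mul_le_mul_of_nonneg_left (Finset.abs_sum_le_sum_abs _ _) (by positivity)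
    _ = _ := by
        rw [integral_add hDs (hNi n).abs, integral_const_mul,
          integral_finsetSum _ fun k _ => hDa k]
        rfl

end Covariances

/-! ### From convergence in mean to convergence in probability -/

/-- Countably many sequences of random variables that converge to zero in mean converge to zero
almost surely along one common subsequence: the `k`-th index is chosen so that the first `k` means
are at most `2⁻ᵏ`. -/
theorem exists_common_subseq_tendsto_ae {Ω : Type*} [MeasurableSpace Ω] {P : Measure Ω}
    {Y : ℕ → ℕ → Ω → ℝ} (hY : ∀ i n, Integrable (Y i n) P)
    (hlim : ∀ i, Tendsto (fun n => ∫ ω, |Y i n ω| ∂P) atTop (𝓝 0)) {ns : ℕ → ℕ}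
    (hns : Tendsto ns atTop atTop) :
    ∃ ms : ℕ → ℕ, (∀ k, 1 ≤ ns (ms k)) ∧
      ∀ᵐ ω ∂P, ∀ i, Tendsto (fun k => Y i (ns (ms k)) ω) atTop (𝓝 0) := by
  have hlim' : ∀ i, Tendsto (fun n => ∫⁻ ω, ‖Y i n ω‖ₑ ∂P) atTop (𝓝 0) := by
    intro i
    have := ENNReal.tendsto_ofReal (hlim i)
    rw [ENNReal.ofReal_zero] at this
    refine this.congr fun n => ?_
    exact ofReal_integral_norm_eq_lintegral_enorm (hY i n)
  have hex : ∀ k : ℕ, ∃ m, 1 ≤ ns m ∧ ∀ i ∈ Finset.range k,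
      ∫⁻ ω, ‖Y i (ns m) ω‖ₑ ∂P ≤ (2⁻¹ : ENNReal) ^ k := by
    intro k
    refine ((hns.eventually_ge_atTop 1).and ((Finset.range k).eventually_all.2 fun i _ => ?_)).exists
    exact ((hlim' i).comp hns).eventually_le_const (ENNReal.pow_pos (by simp) k)
  choose ms h1 h2 using hex
  refine ⟨ms, h1, ae_all_iff.2 fun i => ?_⟩
  have hmeas : ∀ k, AEMeasurable (fun ω => ‖Y i (ns (ms (k + (i + 1)))) ω‖ₑ) P :=
    fun k => (hY i _).1.enorm
  have hfin : ∫⁻ ω, ∑' k, ‖Y i (ns (ms (k + (i + 1)))) ω‖ₑ ∂P ≠ ⊤ := by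
    rw [lintegral_tsum hmeas]
    refine ne_top_of_le_ne_top ?_ (ENNReal.tsum_le_tsum fun k =>
      (h2 (k + (i + 1)) i (Finset.mem_range.2 (by omega))).trans
        (pow_le_pow_right_of_le_one' (by simp) (Nat.le_add_right k (i + 1))))
    rw [ENNReal.tsum_geometric]
    simp
  filter_upwards [ae_lt_top' (AEMeasurable.tsum hmeas) hfin] with ω hω
  have ht := ENNReal.tendsto_atTop_zero_of_tsum_ne_top hω.ne
  have ht' := (tendsto_add_atTop_iff_nat (f := fun k => ‖Y i (ns (ms k)) ω‖ₑ) (i + 1)).1 ht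
  rw [tendsto_zero_iff_norm_tendsto_zero]
  have := (ENNReal.tendsto_toReal ENNReal.zero_ne_top).comp ht'
  simpa [Function.comp_def] using this

end Farima

theorem theorem1 {Ω : Type*} [MeasurableSpace Ω] (P : Measure Ω) [IsProbabilityMeasure P]
    (p q : ℕ) (δ d₁ d₂ v : ℝ) (θ₀ : Farima.Param p q) (X ε : ℤ → Ω → ℝ)
    (θhat : ℕ → Ω → Farima.Param p q)
    (hd₁ : -(1 / 2) < d₁) (hd₂ : d₂ < 1 / 2) (hd₀ : -(1 / 2) < d₁ - Farima.mem θ₀)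
    (hδ : 0 < δ) (hθ₀ : θ₀ ∈ Farima.paramSet p q δ d₁ d₂)
    (hX : Farima.IsCenteredStationary P X)
    (hXε : Farima.IsFarima P θ₀ X ε)
    (hA0 : Farima.IsWeakWhiteNoise P ε v)
    (hA1 : Farima.RootConditions θ₀)
    (hA2 : Farima.IsStationaryErgodic P ε)
    (hθhat : Farima.IsLeastSquaresEstimator P X (Farima.paramSet p q δ d₁ d₂) θhat) :
    TendstoInMeasure P θhat atTop (fun _ => θ₀) := by
  have hr := Farima.tendsto_lpNorm_deviation hδ hθ₀ hX hXε hA0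
  set Y : ℕ × ℕ → ℕ → Ω → ℝ := fun i n ω =>
    Farima.lagCov (Farima.lsResidual θ₀ (fun s => X s ω)) n i.1 i.2 - if i.1 = i.2 then v else 0
    with hY
  have hYi : ∀ i n, Integrable (Y i n) P := fun i n =>
    ((integrable_finsetSum _ fun t _ =>
      (Farima.memLp_lsResidual hX.memLp θ₀ (t - i.1)).integrable_mul
        (Farima.memLp_lsResidual hX.memLp θ₀ (t - i.2))).const_mul _).sub (integrable_const _)
  intro η hη
  refine tendsto_of_subseq_tendsto fun ns hns => ?_
  obtain ⟨ms, hms, hae⟩ := Farima.exists_common_subseq_tendsto_ae (P := P)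
    (Y := fun m => Y m.unpair) (fun m n => hYi _ n)
    (fun m => Farima.tendsto_integral_lagCov hX.memLp hA0 hA2 hr _ _) hns
  refine ⟨ms, ?_⟩
  have hconv : TendstoInMeasure P (fun k => θhat (ns (ms k))) atTop (fun _ => θ₀) := by
    refine tendstoInMeasure_of_tendsto_ae (fun k => (hθhat _ (hms k)).1.aestronglyMeasurable) ?_
    have hmin := ae_all_iff.2 fun k => (hθhat _ (hms k)).2
    filter_upwards [hae, hmin] with ω hω hm
    refine Farima.tendsto_of_lagCov_tendsto hd₁ hd₂ hd₀ hδ hθ₀ hA1 hA0.var_pos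
      (x := fun s => X s ω) (n := fun k => ns (ms k)) (fun j l => ?_) (fun k => (hm k).1)
      (fun k => (hm k).2 θ₀ hθ₀)
    have h := (hω (Nat.pair j l)).add_const (if j = l then v else 0)
    simpa [hY] using h
  exact hconv η hη
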